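/- **Setting.** Let $S\subset\mathbb C^2$ be an open neighbourhood of $0$, with coordinates $(s,t)$, stable under complex conjugation (a coordinate neighbourhood of a real point $0$ of a smooth real surface). A holomorphic function, map or matrix on $S$ is called *real* if it commutes with complex conjugation. A *real conic bundle* $f:Y\to S$ is given by a real holomorphic family $Q_{(s,t)}(x,y,z)$ of quadratic forms, nonzero for every $(s,t)\in S$: $Y=(Q_{(s,t)}(x,y,z)=0)\subset\mathbb P^2_{x:y:z}\times S$ and $f$ is the second projection; each fibre is a smooth conic, a pair of lines or a double line. An $f$-equivariant action of $\mathbb Z_m$ on $Y\to S$ is an action on $S$ by real biholomorphic maps $\sigma_k$ together with a compatible action on the $\mathbb P^2$-bundle $\mathbb P^2\times S$ of the form $([v],p)\mapsto([A_k(p)v],\sigma_k(p))$, with $A_k$ a real holomorphic family of invertible $3\times 3$ matrices, that maps each conic $f^{-1}(p)$ to the conic $f^{-1}(\sigma_k(p))$. Let $R_{a,m}(u,v)$ denote the 2-dimensional real representation of $\mathbb Z_m$ in which the chosen generator acts by rotation by $2\pi a/m$, that is, $u\mapsto \cos(2\pi a/m)u+\sin(2\pi a/m)v$, $v\mapsto-\sin(2\pi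 a/m)u+\cos(2\pi a/m)v$, and let $\mathbf 1$ be the trivial 1-dimensional representation. **Theorem.** Let $m\ge 2$ and let $f:Y\to S$ be a real conic bundle with an $f$-equivariant $\mathbb Z_m$-action fixing $0\in S$. Assume that $Y$ has only isolated singularities, that the central fibre $f^{-1}(0)$ has a real point, and that every $k\in\mathbb Z_m$ with $k\ne 1$ has only isolated and nonreal fixed points on the set of complex points of $Y$. Then, for a suitable choice of the generator of $\mathbb Z_m$ and after shrinking $S$ to a smaller invariant neighbourhood of $0$, $f:Y\to S$ is $\mathbb Z_m$-equivariantly and real analytically equivalent (by a real biholomorphic change of the coordinates $(s,t)$ fixing $0$ and a real holomorphic, fibrewise linear change of the homogeneous coordinates $(x:y:z)$) to one of the following normal forms: 1. $Y=(z^2-x^2-y^2+h_1(x,y,z,s,t)=0)$, where $\mathbb Z_m$ acts on the base by $R_{b,m}(s,t)$ for some $b$ with $(b,m)=1$; or 2. $m$ is odd, $Y=(z^2+sx^2+2txy-sy^2+h_2(x,y,z,s,t)=0)$, and $\mathbb Z_m$ acts on the base by $R_{2,m}(s,t)$ (that is, $b=2$). In both cases $\mathbb Z_m$ acts on $\mathbb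 P^2_{x:y:z}$ through the representation $\mathbf 1(z)\oplus R_{1,m}(x,y)$, and $h_i$ is a quadratic form in $x,y,z$ whose coefficients are real holomorphic functions of $(s,t)$ near $0$ lying in $(s,t)^i$. -/

import Mathlib

open Filter Topology Asymptotics

/-- Local complex coordinates `(s, t)` on the base. Complex conjugation is `star`. -/
abbrev BaseC := Fin 2 → ℂ

/-- Homogeneous coordinates `(x, y, z)` on the projective plane. -/
abbrev FibC := Fin 3 → ℂ

/-- The value at `v = (x, y, z)` of the quadratic form with matrix `M`. -/
def quadVal (M : Matrix (Fin 3) (Fin 3) ℂ) (v : FibC) : ℂ := v ⬝ᵥ M.mulVec v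

/-- All entries of the matrix-valued function `M` are complex analytic on the open set `U`. -/
def MatAnalyticOn (M : BaseC → Matrix (Fin 3) (Fin 3) ℂ) (U : Set BaseC) : Prop :=
  ∀ i j, AnalyticOnNhd ℂ (fun s => M s i j) U

/-- The matrix-valued function `M` is real, i.e. it commutes with complex conjugation on `U`
(equivalently, its power series at real points have real coefficients). -/
def MatRealOn (M : BaseC → Matrix (Fin 3) (Fin 3) ℂ) (U : Set BaseC) : Prop :=
  ∀ s ∈ U, M (star s) = (M s).map star

/-- A real conic bundle over a neighbourhood `S` of the real point `0` of a smooth real surface, in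
local coordinates: `S` is a conjugation-invariant open neighbourhood of `0` in `ℂ²`, and the total
space `Y ⊆ ℙ² × S` is given by one equation, a nowhere vanishing quadratic form in `(x, y, z)`
whose coefficients are real analytic functions of `(s, t)`. The bundle map is the second
projection. Every fibre is a smooth conic, a pair of lines or a double line. -/
structure RealConicBundle where
  /-- the base -/
  S : Set BaseC
  isOpen_S : IsOpen S
  zero_mem : (0 : BaseC) ∈ S
  star_mem : ∀ s ∈ S, star s ∈ S
  /-- the symmetric matrix of the equation of the fibre over `s` -/
  Q : BaseC → Matrix (Fin 3) (Fin 3) ℂ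
  analytic : MatAnalyticOn Q S
  real : MatRealOn Q S
  symm : ∀ s ∈ S, (Q s).IsSymm
  ne_zero : ∀ s ∈ S, Q s ≠ 0

namespace RealConicBundle

/-- The equation of `Y` as a function of `((x, y, z), (s, t))`. -/
def eqn (X : RealConicBundle) (p : FibC × BaseC) : ℂ := quadVal (X.Q p.2) p.1

/-- The complex points of `Y ⊆ ℙ² × S`, in homogeneous coordinates: `(v, s)` stands for the point
`([v], s)`. -/
def total (X : RealConicBundle) : Set (FibC × BaseC) :=
  {p | p.1 ≠ 0 ∧ p.2 ∈ X.S ∧ X.eqn p = 0}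

/-- The singular points of `Y`, by the Jacobian criterion. -/
def sing (X : RealConicBundle) : Set (FibC × BaseC) :=
  {p | p ∈ X.total ∧ fderiv ℂ X.eqn p = 0}

end RealConicBundle

/-- The point `([v], s)` of `ℙ² × ℂ²` is real, i.e. fixed by complex conjugation. -/
def IsRealPt (p : FibC × BaseC) : Prop :=
  star p.2 = p.2 ∧ ∃ c : ℂ, star p.1 = c • p.1

/-- `Z` is a set of points `([v], s)` of `ℙ² × ℂ²` in homogeneous coordinates. All its points are
isolated: near `([v], s) ∈ Z` there is no other point of `Z`. -/
def OnlyIsolatedPts (Z : Set (FibC × BaseC)) : Prop :=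
  ∀ p ∈ Z, ∃ U ∈ 𝓝 p, ∀ q ∈ U ∩ Z, q.2 = p.2 ∧ ∃ c : ℂ, q.1 = c • p.1

/-- An action of `ℤ/m` on a real conic bundle, compatible with the bundle map: `k` acts on the base
by `σ k`, and on `ℙ² × S` by `([v], s) ↦ ([A k s v], σ k s)`, where `σ k` and `A k` are real
analytic and `A k s` is invertible. Matrices matter only up to nonzero scalars, so this is an
action on the `ℙ²`-bundle, and no linear action on the rank 3 vector bundle is chosen. Each `k`
takes the conic `Y_s` to the conic `Y_{σ k s}`, hence `Y` to `Y`.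
(The ambient `ℙ²`-bundle of a conic bundle is the projectivization of the direct image of the
relative anticanonical sheaf, so automorphisms of `Y` over `S` are of this kind.) -/
structure ConicBundleAction (X : RealConicBundle) (m : ℕ) where
  σ : ZMod m → BaseC → BaseC
  A : ZMod m → BaseC → Matrix (Fin 3) (Fin 3) ℂ
  σ_mapsTo : ∀ k, Set.MapsTo (σ k) X.S X.S
  σ_analytic : ∀ k, AnalyticOnNhd ℂ (σ k) X.S
  σ_real : ∀ k, ∀ s ∈ X.S, σ k (star s) = star (σ k s)
  σ_zero : ∀ s ∈ X.S, σ 0 s = s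
  σ_add : ∀ k l, ∀ s ∈ X.S, σ (k + l) s = σ k (σ l s)
  A_analytic : ∀ k, MatAnalyticOn (A k) X.S
  A_real : ∀ k, MatRealOn (A k) X.S
  A_det : ∀ k, ∀ s ∈ X.S, (A k s).det ≠ 0
  A_zero : ∀ s ∈ X.S, ∃ c : ℂ, c ≠ 0 ∧ A 0 s = c • (1 : Matrix (Fin 3) (Fin 3) ℂ)
  A_add : ∀ k l, ∀ s ∈ X.S, ∃ c : ℂ, c ≠ 0 ∧ A (k + l) s = c • (A k (σ l s) * A l s)
  preserves : ∀ k, ∀ s ∈ X.S, ∃ c : ℂ, c ≠ 0 ∧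
    ∀ v, quadVal (X.Q (σ k s)) ((A k s).mulVec v) = c * quadVal (X.Q s) v

/-- The fixed points of `k` on the complex points of `Y`. -/
def ConicBundleAction.fixedPts {X : RealConicBundle} {m : ℕ} (α : ConicBundleAction X m)
    (k : ZMod m) : Set (FibC × BaseC) :=
  {p | p ∈ X.total ∧ α.σ k p.2 = p.2 ∧ ∃ c : ℂ, (α.A k p.2).mulVec p.1 = c • p.1}

noncomputable section

/-- The matrix of the `j`-th power of the generator in `𝟏(z) ⊕ R_{1,m}(x, y)`,
in the coordinates `(x, y, z)`. -/
def fibRot (m j : ℕ) : Matrix (Fin 3) (Fin 3) ℂ :=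
  let θ : ℝ := 2 * Real.pi * j / m
  !![(Real.cos θ : ℂ), (Real.sin θ : ℂ), 0;
     -(Real.sin θ : ℂ), (Real.cos θ : ℂ), 0;
     0, 0, 1]

/-- The matrix of the `j`-th power of the generator in `R_{b,m}(s, t)`. -/
def baseRot (m b j : ℕ) : Matrix (Fin 2) (Fin 2) ℂ :=
  let θ : ℝ := 2 * Real.pi * b * j / m
  !![(Real.cos θ : ℂ), (Real.sin θ : ℂ);
     -(Real.sin θ : ℂ), (Real.cos θ : ℂ)]

/-- The quadratic form `z² - x² - y²`. -/
def normalForm₁ (_ : BaseC) (v : FibC) : ℂ := v 2 ^ 2 - v 0 ^ 2 - v 1 ^ 2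

/-- The quadratic form `z² + s x² + 2 t x y - s y²`. -/
def normalForm₂ (w : BaseC) (v : FibC) : ℂ :=
  v 2 ^ 2 + w 0 * v 0 ^ 2 + 2 * w 1 * v 0 * v 1 - w 0 * v 1 ^ 2

end

/-- `X` with its `ℤ/m`-action is, near the central fibre, equivariantly and real analytically
equivalent to the conic bundle `N + h = 0`, where `h` is a quadratic form in `(x, y, z)` whose
coefficients are real analytic functions of `(s, t)` that vanish at `0` to order at least `i`
(i.e. lie in `(s, t)^i`), and where the generator `g` of `ℤ/m` acts by `𝟏(z) ⊕ R_{1,m}(x, y)` on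
the fibre coordinates and by `R_{b,m}(s, t)` on the base.

The equivalence is `([v], s) ↦ ([B s v], ψ s)` with `ψ` a real biholomorphic map of neighbourhoods
of `0` and `B` real analytic with invertible values. -/
def EquivariantlyEquivalent {X : RealConicBundle} {m : ℕ} (α : ConicBundleAction X m)
    (g : ZMod m) (b : ℕ) (N : BaseC → FibC → ℂ) (i : ℕ) : Prop :=
  ∃ (ψ : OpenPartialHomeomorph BaseC BaseC) (B H : BaseC → Matrix (Fin 3) (Fin 3) ℂ),
    -- `ψ` is a real biholomorphic map defined on an invariant neighbourhood of `0`
    ((0 : BaseC) ∈ ψ.source ∧ ψ 0 = 0 ∧ ψ.source ⊆ X.S ∧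
      (∀ s ∈ ψ.source, star s ∈ ψ.source) ∧
      (∀ k, Set.MapsTo (α.σ k) ψ.source ψ.source) ∧
      AnalyticOnNhd ℂ ψ ψ.source ∧ AnalyticOnNhd ℂ ψ.symm ψ.target ∧
      (∀ s ∈ ψ.source, ψ (star s) = star (ψ s))) ∧
    -- `B` is a real analytic change of the fibre coordinates
    (MatAnalyticOn B ψ.source ∧ MatRealOn B ψ.source ∧ ∀ s ∈ ψ.source, (B s).det ≠ 0) ∧
    -- `h` is real analytic of order at least `i`
    (MatAnalyticOn H ψ.target ∧ MatRealOn H ψ.target ∧ (∀ w ∈ ψ.target, (H w).IsSymm) ∧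
      ∀ j k, (fun w => H w j k) =O[𝓝 0] fun w => ‖w‖ ^ i) ∧
    -- the equation of `X` becomes `N + h = 0`
    (∀ s ∈ ψ.source, ∃ c : ℂ, c ≠ 0 ∧ ∀ v,
      N (ψ s) ((B s).mulVec v) + quadVal (H (ψ s)) ((B s).mulVec v) = c * quadVal (X.Q s) v) ∧
    -- the action becomes the linear one
    (∀ j : ℕ, ∀ s ∈ ψ.source,
      ψ (α.σ (j * g) s) = (baseRot m b j).mulVec (ψ s) ∧
      ∃ c : ℂ, c ≠ 0 ∧ B (α.σ (j * g) s) * α.A (j * g) s = c • (fibRot m j * B s))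

/-! The proof averages over the finite group and then does linear algebra at the origin. Rescaled to
determinant one, the matrices of the action form an honest cocycle (`exists_cocycle`): the remaining
ambiguity is a real germ whose cube is 1, hence 1. Averaging against the values at the origin makes
the action on the fibre coordinates constant (`exists_fibre_linearization`). It is faithful, because
an element acting trivially on the central plane would fix the given real point. So it is a rotation
of order m about an axis, and the choice of generator makes its angle 2π/m.

The real point (0:0:1) is fixed by the rotation, hence lies off the central conic. So z² has a unit
coefficient, and completing the square equivariantly gives z² plus an invariant binary form ax² +
2bxy + cy² (`exists_isBlockForm`). Over the origin this form is a multiple of x² + y² if m ≥ 3, and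
it is definite if m is even, since the half turn fixes the line z = 0 pointwise. As the central
fibre has a real point, the form is negative definite, or m is odd and the form vanishes
(`central_fibre`).

The base action is linearized by the same averaging. If a nontrivial element had eigenvalue 1 on the
tangent space, a curve of its fixed points on the base would lift to a curve of fixed points on Y
(`exists_fixed_section`, `det_sub_one_ne_zero`), contrary to isolatedness. So the base action is a
rotation of exact order m (`exists_base_rotation`).

In the definite case a constant Cholesky change of x, y gives the first normal form. In the other
case the linear part of (a, b, c) is an equivariant map from the tangent plane to binary forms. It
is trace free, because the base rotation has no eigenvalue 1, and it is nonzero, because otherwise Y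
would be singular along the line z = 0. Trace-free binary forms have weights ±2, so the base has
weight 2 up to reflection, and the linear parts of a and b are the coordinates s and t
(`equivariantlyEquivalent_double_line`). -/

/-! ### Calculus of real holomorphic germs. -/

/-- `f` is holomorphic at the origin and commutes with complex conjugation near the origin. -/
def RealGerm (f : BaseC → ℂ) : Prop :=
  AnalyticAt ℂ f 0 ∧ ∀ᶠ s in 𝓝 (0 : BaseC), f (star s) = star (f s)

/-- All entries of a matrix-valued function are real germs. -/
def MatGerm {ι κ : Type*} (M : BaseC → Matrix ι κ ℂ) : Prop :=
  ∀ i j, RealGerm fun s => M s i j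

/-- All components of a vector-valued function are real germs. -/
def VecGerm {ι : Type*} (φ : BaseC → ι → ℂ) : Prop :=
  ∀ i, RealGerm fun s => φ s i

namespace RealGerm

variable {f g : BaseC → ℂ}

theorem star_value (hf : RealGerm f) : star (f 0) = f 0 := by
  have := hf.2.self_of_nhds
  rw [star_zero] at this
  exact this.symm

theorem im_value (hf : RealGerm f) : (f 0).im = 0 :=
  Complex.conj_eq_iff_im.1 hf.star_value

theorem value_eq_re (hf : RealGerm f) : f 0 = ((f 0).re : ℂ) :=
  Complex.ext (by simp) (by simp [hf.im_value])

theorem continuousAt (hf : RealGerm f) : ContinuousAt f 0 := hf.1.continuousAt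

theorem const {c : ℂ} (hc : star c = c) : RealGerm fun _ => c :=
  ⟨analyticAt_const, Eventually.of_forall fun _ => hc.symm⟩

theorem ofReal (c : ℝ) : RealGerm fun _ => (c : ℂ) := const (Complex.conj_ofReal c)

theorem add (hf : RealGerm f) (hg : RealGerm g) : RealGerm fun s => f s + g s :=
  ⟨hf.1.add hg.1, by filter_upwards [hf.2, hg.2] with s h1 h2; simp [h1, h2]⟩

theorem sub (hf : RealGerm f) (hg : RealGerm g) : RealGerm fun s => f s - g s :=
  ⟨hf.1.sub hg.1, by filter_upwards [hf.2, hg.2] with s h1 h2; simp [h1, h2]⟩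

theorem neg (hf : RealGerm f) : RealGerm fun s => -f s :=
  ⟨hf.1.neg, by filter_upwards [hf.2] with s h1; simp [h1]⟩

theorem mul (hf : RealGerm f) (hg : RealGerm g) : RealGerm fun s => f s * g s :=
  ⟨hf.1.mul hg.1, by filter_upwards [hf.2, hg.2] with s h1 h2; simp [h1, h2]⟩

theorem inv (hf : RealGerm f) (h0 : f 0 ≠ 0) : RealGerm fun s => (f s)⁻¹ :=
  ⟨hf.1.inv h0, by filter_upwards [hf.2] with s h1; simp [h1]⟩

theorem sum {ι : Type*} (t : Finset ι) {F : ι → BaseC → ℂ} (h : ∀ i ∈ t, RealGerm (F i)) :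
    RealGerm fun s => ∑ i ∈ t, F i s :=
  ⟨Finset.analyticAt_fun_sum _ fun i hi => (h i hi).1, by
    filter_upwards [(Finset.eventually_all t).2 fun i hi => (h i hi).2] with s hs
    rw [star_sum]
    exact Finset.sum_congr rfl hs⟩

theorem prod {ι : Type*} (t : Finset ι) {F : ι → BaseC → ℂ} (h : ∀ i ∈ t, RealGerm (F i)) :
    RealGerm fun s => ∏ i ∈ t, F i s :=
  ⟨Finset.analyticAt_fun_prod _ fun i hi => (h i hi).1, by
    filter_upwards [(Finset.eventually_all t).2 fun i hi => (h i hi).2] with s hs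
    rw [star_prod]
    exact Finset.prod_congr rfl hs⟩

/-- The principal branch is holomorphic on the slit plane and commutes with conjugation there; the
value 1 at the origin keeps nearby values inside it. -/
theorem cubeRoot (hf : RealGerm f) (h1 : f 0 = 1) :
    RealGerm fun s => f s ^ (((3 : ℕ) : ℂ)⁻¹) := by
  have hmem : f 0 ∈ Complex.slitPlane := by rw [h1]; exact Complex.one_mem_slitPlane
  refine ⟨hf.1.cpow analyticAt_const hmem, ?_⟩
  filter_upwards [hf.2, hf.continuousAt.eventually (Complex.isOpen_slitPlane.mem_nhds hmem)]
    with s hs hs'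
  rw [hs]
  have := Complex.conj_cpow (f s) (((3 : ℕ) : ℂ)⁻¹) (Complex.slitPlane_arg_ne_pi hs')
  rwa [map_inv₀, Complex.conj_natCast] at this

theorem eventually_ne (hf : RealGerm f) (h0 : f 0 ≠ 0) : ∀ᶠ s in 𝓝 (0 : BaseC), f s ≠ 0 :=
  hf.continuousAt.eventually_ne h0

end RealGerm

namespace VecGerm

variable {ι : Type*} [Fintype ι] {φ : BaseC → ι → ℂ}

theorem analyticAt (hφ : VecGerm φ) : AnalyticAt ℂ φ 0 :=
  AnalyticAt.pi fun i => (hφ i).1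

theorem eventually_star (hφ : VecGerm φ) : ∀ᶠ s in 𝓝 (0 : BaseC), φ (star s) = star (φ s) := by
  filter_upwards [eventually_all.2 fun i => (hφ i).2] with s hs
  exact funext hs

end VecGerm

theorem VecGerm.tendsto {φ : BaseC → BaseC} (hφ : VecGerm φ) (h0 : φ 0 = 0) :
    Tendsto φ (𝓝 0) (𝓝 0) := by
  have := hφ.analyticAt.continuousAt.tendsto
  rwa [h0] at this

theorem RealGerm.comp {f : BaseC → ℂ} {φ : BaseC → BaseC} (hf : RealGerm f) (hφ : VecGerm φ)
    (h0 : φ 0 = 0) : RealGerm fun s => f (φ s) := by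
  refine ⟨AnalyticAt.fun_comp (by rw [h0]; exact hf.1) hφ.analyticAt, ?_⟩
  filter_upwards [hφ.eventually_star, (hφ.tendsto h0).eventually hf.2] with s h1 h2
  rw [h1, h2]

namespace MatGerm

variable {ι κ τ : Type*} [Fintype κ]

theorem comp {M : BaseC → Matrix ι τ ℂ} {φ : BaseC → BaseC} (hM : MatGerm M) (hφ : VecGerm φ)
    (h0 : φ 0 = 0) : MatGerm fun s => M (φ s) := fun i j => (hM i j).comp hφ h0

theorem ofReal (M : Matrix ι τ ℝ) : MatGerm fun _ => M.map Complex.ofReal :=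
  fun i j => RealGerm.ofReal (M i j)

theorem mul {M : BaseC → Matrix ι κ ℂ} {N : BaseC → Matrix κ τ ℂ} (hM : MatGerm M)
    (hN : MatGerm N) : MatGerm fun s => M s * N s := fun i j => by
  simp only [Matrix.mul_apply]
  exact RealGerm.sum _ fun k _ => (hM i k).mul (hN k j)

theorem transpose {M : BaseC → Matrix ι τ ℂ} (hM : MatGerm M) : MatGerm fun s => (M s).transpose :=
  fun i j => hM j i

theorem smul {f : BaseC → ℂ} {M : BaseC → Matrix ι τ ℂ} (hf : RealGerm f) (hM : MatGerm M) :
    MatGerm fun s => f s • M s := fun i j => hf.mul (hM i j)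

theorem sum {β : Type*} (t : Finset β) {F : β → BaseC → Matrix ι τ ℂ}
    (h : ∀ i ∈ t, MatGerm (F i)) : MatGerm fun s => ∑ i ∈ t, F i s := fun i j => by
  simp only [Matrix.sum_apply]
  exact RealGerm.sum t fun k hk => h k hk i j

theorem mulVec {M : BaseC → Matrix ι κ ℂ} {φ : BaseC → κ → ℂ} (hM : MatGerm M) (hφ : VecGerm φ) :
    VecGerm fun s => (M s).mulVec (φ s) := fun i => by
  simp only [Matrix.mulVec, dotProduct]
  exact RealGerm.sum _ fun k _ => (hM i k).mul (hφ k)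

theorem trace {M : BaseC → Matrix κ κ ℂ} (hM : MatGerm M) : RealGerm fun s => (M s).trace :=
  RealGerm.sum _ fun i _ => hM i i

theorem exists_real {M : BaseC → Matrix ι τ ℂ} (hM : MatGerm M) :
    ∃ N : Matrix ι τ ℝ, M 0 = N.map Complex.ofReal :=
  ⟨Matrix.of fun i j => (M 0 i j).re, by ext i j; simpa using (hM i j).value_eq_re⟩

theorem eventually_star {M : BaseC → Matrix κ κ ℂ} (hM : MatGerm M) :
    ∀ᶠ s in 𝓝 (0 : BaseC), M (star s) = (M s).map star := by
  filter_upwards [eventually_all.2 fun i => eventually_all.2 fun j => (hM i j).2] with s hs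
  ext i j
  exact hs i j

variable [DecidableEq κ] {M : BaseC → Matrix κ κ ℂ}

theorem det (hM : MatGerm M) : RealGerm fun s => (M s).det := by
  simp only [Matrix.det_apply']
  refine RealGerm.sum _ fun p _ => RealGerm.mul (RealGerm.const ?_)
    (RealGerm.prod _ fun i _ => hM _ _)
  simp

theorem adjugate (hM : MatGerm M) : MatGerm fun s => (M s).adjugate := fun i j => by
  simp only [Matrix.adjugate_apply]
  refine MatGerm.det fun k l => ?_
  by_cases hk : k = j
  · subst hk
    simp only [Matrix.updateRow_self]
    refine RealGerm.const ?_
    by_cases hl : l = i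
    · subst hl; simp
    · simp [hl]
  · simp only [Matrix.updateRow_ne hk]
    exact hM k l

theorem inv (hM : MatGerm M) (h0 : (M 0).det ≠ 0) : MatGerm fun s => (M s)⁻¹ := by
  simp only [Matrix.inv_def, Ring.inverse_eq_inv]
  exact smul (hM.det.inv h0) hM.adjugate

theorem eventually_det_ne (hM : MatGerm M) (h0 : (M 0).det ≠ 0) :
    ∀ᶠ s in 𝓝 (0 : BaseC), (M s).det ≠ 0 := hM.det.eventually_ne h0

end MatGerm

theorem MatAnalyticOn.matGerm {M : BaseC → Matrix (Fin 3) (Fin 3) ℂ} {U : Set BaseC}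
    (h : MatAnalyticOn M U) (h' : MatRealOn M U) (hU : IsOpen U) (h0 : (0 : BaseC) ∈ U) :
    MatGerm M := fun i j =>
  ⟨h i j 0 h0, by
    filter_upwards [hU.mem_nhds h0] with s hs
    rw [h' s hs, Matrix.map_apply]⟩

/-! ### Real matrices of finite order are conjugate to rotations. -/

-- The standard inner product averaged over the powers of M is an invariant positive definite form
-- G; writing G = CᵀC, the matrix C carries it to the standard one.
open scoped MatrixOrder in
theorem exists_orthogonal_conj {n : Type*} [Fintype n] [DecidableEq n] (M : Matrix n n ℝ) {m : ℕ}
    (hm : 0 < m) (hM : M ^ m = 1) :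
    ∃ C : Matrix n n ℝ, C.det ≠ 0 ∧ (C * M * C⁻¹).transpose * (C * M * C⁻¹) = 1 := by
  obtain ⟨r, rfl⟩ : ∃ r, m = r + 1 := ⟨m - 1, by omega⟩
  set G : Matrix n n ℝ := ∑ j ∈ Finset.range (r + 1), (M ^ j).transpose * M ^ j with hG
  have hinv : M.transpose * G * M = G := by
    have h1 : M.transpose * G * M =
        ∑ j ∈ Finset.range (r + 1), (M ^ (j + 1)).transpose * M ^ (j + 1) := by
      rw [hG, Finset.mul_sum, Finset.sum_mul]
      refine Finset.sum_congr rfl fun j _ => ?_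
      rw [pow_succ, Matrix.transpose_mul]
      simp only [Matrix.mul_assoc]
    rw [h1, Finset.sum_range_succ, hG, Finset.sum_range_succ', hM]
    simp
  have hpos : G.PosDef := by
    rw [hG, Finset.sum_range_succ']
    refine Matrix.PosDef.posSemidef_add ?_ ?_
    · refine Matrix.posSemidef_sum _ fun j _ => ?_
      simpa using Matrix.posSemidef_conjTranspose_mul_self (M ^ (j + 1))
    · simpa using Matrix.PosDef.one
  obtain ⟨C, hC⟩ := CStarAlgebra.nonneg_iff_eq_star_mul_self.mp hpos.posSemidef.nonneg
  have hC' : C.transpose * C = G := by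
    rw [hC, Matrix.star_eq_conjTranspose, Matrix.conjTranspose_eq_transpose_of_trivial]
  have hdet : C.det ≠ 0 := fun h => by
    have := hpos.det_pos
    rw [← hC', Matrix.det_mul, h] at this
    simp at this
  refine ⟨C, hdet, ?_⟩
  have hu : IsUnit C.det := hdet.isUnit
  calc (C * M * C⁻¹).transpose * (C * M * C⁻¹)
      = C⁻¹.transpose * (M.transpose * (C.transpose * C) * M) * C⁻¹ := by
        simp only [Matrix.transpose_mul, Matrix.mul_assoc]
    _ = (C * C⁻¹).transpose * (C * C⁻¹) := by
        rw [hC', hinv, ← hC', Matrix.transpose_mul]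
        simp only [Matrix.mul_assoc]
    _ = 1 := by rw [Matrix.mul_nonsing_inv _ hu]; simp

/-- The rotation matrix of size two attached to a complex number of modulus one. -/
def rotTwo (z : ℂ) : Matrix (Fin 2) (Fin 2) ℝ := !![z.re, z.im; -z.im, z.re]

/-- The rotation matrix about the third axis attached to a complex number of modulus one. -/
def rotThree (z : ℂ) : Matrix (Fin 3) (Fin 3) ℝ := !![z.re, z.im, 0; -z.im, z.re, 0; 0, 0, 1]

theorem rotTwo_one : rotTwo 1 = 1 := by
  ext i j; fin_cases i <;> fin_cases j <;> simp [rotTwo]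

theorem rotThree_one : rotThree 1 = 1 := by
  ext i j; fin_cases i <;> fin_cases j <;> simp [rotThree]

theorem rotTwo_mul (z w : ℂ) : rotTwo (z * w) = rotTwo z * rotTwo w := by
  ext i j; fin_cases i <;> fin_cases j <;>
    simp [rotTwo, Matrix.mul_apply, Fin.sum_univ_succ] <;> ring

theorem rotThree_mul (z w : ℂ) : rotThree (z * w) = rotThree z * rotThree w := by
  ext i j; fin_cases i <;> fin_cases j <;>
    simp [rotThree, Matrix.mul_apply, Fin.sum_univ_succ] <;> ring

theorem rotTwo_pow (z : ℂ) (j : ℕ) : rotTwo (z ^ j) = rotTwo z ^ j := by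
  induction j with
  | zero => simp [rotTwo_one]
  | succ j ih => rw [pow_succ, pow_succ, rotTwo_mul, ih]

theorem rotThree_pow (z : ℂ) (j : ℕ) : rotThree (z ^ j) = rotThree z ^ j := by
  induction j with
  | zero => simp [rotThree_one]
  | succ j ih => rw [pow_succ, pow_succ, rotThree_mul, ih]

theorem rotTwo_injective : Function.Injective rotTwo := fun z w h =>
  Complex.ext (by simpa [rotTwo] using congrFun (congrFun h 0) 0)
    (by simpa [rotTwo] using congrFun (congrFun h 0) 1)

theorem rotThree_injective : Function.Injective rotThree := fun z w h =>
  Complex.ext (by simpa [rotThree] using congrFun (congrFun h 0) 0)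
    (by simpa [rotThree] using congrFun (congrFun h 0) 1)

theorem det_conj_eq {n : Type*} [Fintype n] [DecidableEq n] {C M : Matrix n n ℝ}
    (hC : C.det ≠ 0) : (C * M * C⁻¹).det = M.det := by
  rw [Matrix.det_mul, Matrix.det_mul, mul_right_comm, ← Matrix.det_mul,
    Matrix.mul_nonsing_inv _ hC.isUnit, Matrix.det_one, one_mul]

theorem conj_pow_eq {n : Type*} [Fintype n] [DecidableEq n] {C M : Matrix n n ℝ}
    (hC : C.det ≠ 0) (j : ℕ) : (C * M * C⁻¹) ^ j = C * M ^ j * C⁻¹ := by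
  induction j with
  | zero => simp [Matrix.mul_nonsing_inv _ hC.isUnit]
  | succ j ih =>
    rw [pow_succ, ih, pow_succ]
    simp only [Matrix.mul_assoc, Matrix.nonsing_inv_mul_cancel_left _ _ hC.isUnit]

theorem conj_sub_one {n : Type*} [Fintype n] [DecidableEq n] {C M : Matrix n n ℝ}
    (hC : C.det ≠ 0) : C * M * C⁻¹ - 1 = C * (M - 1) * C⁻¹ := by
  rw [Matrix.mul_sub, Matrix.sub_mul, Matrix.mul_one, Matrix.mul_nonsing_inv _ hC.isUnit]

theorem eq_and_eq_neg_of_orthogonal {a b c d : ℝ} (h00 : a * a + c * c = 1)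
    (h11 : b * b + d * d = 1) (hdet : a * d - b * c = 1) : d = a ∧ c = -b := by
  have h : (d - a) ^ 2 + (b + c) ^ 2 = 0 := by linear_combination h00 + h11 - 2 * hdet
  constructor
  · nlinarith [sq_nonneg (d - a), sq_nonneg (b + c)]
  · nlinarith [sq_nonneg (d - a), sq_nonneg (b + c)]

theorem exists_conj_rotTwo (M : Matrix (Fin 2) (Fin 2) ℝ) {m : ℕ} (hm : 0 < m) (hM : M ^ m = 1)
    (h1 : (M - 1).det ≠ 0) :
    ∃ (P : Matrix (Fin 2) (Fin 2) ℝ) (z : ℂ), P.det ≠ 0 ∧ P * M * P⁻¹ = rotTwo z := by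
  obtain ⟨C, hC, hO⟩ := exists_orthogonal_conj M hm hM
  have h1' : (C * M * C⁻¹ - 1).det ≠ 0 := by rwa [conj_sub_one hC, det_conj_eq hC]
  set N := C * M * C⁻¹ with hN
  have e00 := congrFun (congrFun hO 0) 0
  have e01 := congrFun (congrFun hO 0) 1
  have e11 := congrFun (congrFun hO 1) 1
  simp [Matrix.mul_apply, Fin.sum_univ_two] at e00 e01 e11
  simp [Matrix.det_fin_two] at h1'
  set a := N 0 0
  set b := N 0 1
  set c := N 1 0
  set d := N 1 1
  have hdet2 : (a * d - b * c) ^ 2 = 1 := by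
    linear_combination (a * a + c * c) * e11 + e00 - (a * b + c * d) * e01
  have hdet : a * d - b * c = 1 := by
    rcases sq_eq_one_iff.1 hdet2 with h | h
    · exact h
    -- An orthogonal matrix of determinant -1 is a reflection: its trace vanishes, so 1 is an
    -- eigenvalue, which is excluded.
    · refine (h1' ?_).elim
      have h3 : a + d = 0 := by nlinarith [sq_nonneg (a + d), sq_nonneg (b - c)]
      linear_combination h - h3
  obtain ⟨h3, h4⟩ := eq_and_eq_neg_of_orthogonal e00 e11 hdet
  refine ⟨C, ⟨a, b⟩, hC, ?_⟩
  rw [← hN]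
  ext i j
  fin_cases i <;> fin_cases j
  · rfl
  · rfl
  · exact h4
  · exact h3

theorem exists_conj_rotThree (M : Matrix (Fin 3) (Fin 3) ℝ) {m : ℕ} (hm : 0 < m) (hM : M ^ m = 1)
    (hdet : M.det = 1) :
    ∃ (P : Matrix (Fin 3) (Fin 3) ℝ) (z : ℂ), P.det ≠ 0 ∧ P * M * P⁻¹ = rotThree z := by
  obtain ⟨C, hC, hO⟩ := exists_orthogonal_conj M hm hM
  have hNdet : (C * M * C⁻¹).det = 1 := by rw [det_conj_eq hC, hdet]
  set N := C * M * C⁻¹ with hN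
  -- Existence of the axis: (N - 1)ᵀN = -(N - 1), and in odd size the determinant of the right side
  -- is -det(N - 1).
  have hN1 : (N - 1).det = 0 := by
    have h1 : (N - 1).transpose * N = -(N - 1) := by
      rw [Matrix.transpose_sub, Matrix.sub_mul, hO]; simp
    have h2 := congrArg Matrix.det h1
    rw [Matrix.det_mul, Matrix.det_transpose, hNdet, Matrix.det_neg] at h2
    simp at h2
    linarith
  obtain ⟨v, hv0, hv⟩ := Matrix.exists_mulVec_eq_zero_iff.2 hN1
  rw [Matrix.sub_mulVec, Matrix.one_mulVec, sub_eq_zero] at hv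
  let x : EuclideanSpace ℝ (Fin 3) := WithLp.toLp 2 v
  have hx : x ≠ 0 := fun h => hv0 (by simpa [x] using h)
  have hon : Orthonormal ℝ (({2} : Set (Fin 3)).domRestrict fun _ => (‖x‖⁻¹ : ℝ) • x) := by
    refine ⟨fun i => ?_, fun i j hij => (hij (Subsingleton.elim _ _)).elim⟩
    simp [norm_smul, norm_ne_zero_iff.2 hx]
  obtain ⟨b, hb⟩ := hon.exists_orthonormalBasis_extension_of_card_eq (by simp)
  have hb2 : b 2 = (‖x‖⁻¹ : ℝ) • x := hb 2 rfl
  let O : Matrix (Fin 3) (Fin 3) ℝ := Matrix.of fun i j => b j i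
  have hOO : O.transpose * O = 1 := by
    ext i j
    have := orthonormal_iff_ite.1 b.orthonormal j i
    rw [Matrix.one_apply]
    simp only [eq_comm (a := j)] at this
    rw [← this]
    simp [O, Matrix.mul_apply, PiLp.inner_apply]
  have hOdet : O.transpose.det ≠ 0 := fun h => by
    have := congrArg Matrix.det hOO
    rw [Matrix.det_mul, h] at this
    simp at this
  have hOinv : O.transpose⁻¹ = O := Matrix.inv_eq_right_inv hOO
  have hOO' : O * O.transpose = 1 := mul_eq_one_comm.1 hOO
  have hcol : N.mulVec (fun i => O i 2) = fun i => O i 2 := by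
    have : (fun i => O i 2) = (‖x‖⁻¹ : ℝ) • v := by
      ext i; simp [O, hb2, x]
    rw [this, Matrix.mulVec_smul, hv]
  set K := O.transpose * N * O with hK
  have hKK : K.transpose * K = 1 := by
    calc K.transpose * K = O.transpose * (N.transpose * ((O * O.transpose) * N)) * O := by
          simp only [hK, Matrix.transpose_mul, Matrix.transpose_transpose, Matrix.mul_assoc]
      _ = 1 := by rw [hOO', Matrix.one_mul, hO, Matrix.mul_one, hOO]
  have hKdet : K.det = 1 := by
    have := congrArg Matrix.det hOO
    rw [Matrix.det_mul, Matrix.det_one] at this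
    rw [hK, Matrix.det_mul, Matrix.det_mul, hNdet, mul_one, this]
  have hK2 : ∀ i, K i 2 = (1 : Matrix (Fin 3) (Fin 3) ℝ) i 2 := fun i => by
    have h1 : K i 2 = (O.transpose.mulVec (N.mulVec fun i => O i 2)) i := by
      rw [Matrix.mulVec_mulVec]; rfl
    rw [h1, hcol, ← hOO]; rfl
  -- The third row has norm one and its last entry is already 1, so its other entries vanish.
  have hK2' : ∀ i, K 2 i = (1 : Matrix (Fin 3) (Fin 3) ℝ) 2 i := fun i => by
    have h1 : K * K.transpose = 1 := mul_eq_one_comm.1 hKK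
    have h2 := congrFun (congrFun h1 2) 2
    simp [Matrix.mul_apply, Fin.sum_univ_three, hK2] at h2
    have h3 : K 2 0 = 0 := by nlinarith
    have h4 : K 2 1 = 0 := by nlinarith
    fin_cases i
    · simpa using h3
    · simpa using h4
    · exact hK2 2
  have e00 := congrFun (congrFun hKK 0) 0
  have e01 := congrFun (congrFun hKK 0) 1
  have e11 := congrFun (congrFun hKK 1) 1
  simp [Matrix.mul_apply, Fin.sum_univ_three, hK2'] at e00 e01 e11
  have hd := hKdet
  simp [Matrix.det_fin_three, hK2'] at hd
  refine ⟨O.transpose * C, ⟨K 0 0, K 0 1⟩, by rw [Matrix.det_mul]; exact mul_ne_zero hOdet hC, ?_⟩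
  have hfin : O.transpose * C * M * (O.transpose * C)⁻¹ = K := by
    rw [Matrix.mul_inv_rev, hOinv, hK, hN]
    simp only [Matrix.mul_assoc]
  obtain ⟨h3, h4⟩ := eq_and_eq_neg_of_orthogonal e00 e11 hd
  rw [hfin]
  ext i j
  fin_cases i <;> fin_cases j <;> simp [rotThree, hK2, hK2', h3, h4]

/-! ### Rescaling the projective action to a cocycle. -/

theorem Real.exists_cube_root (x : ℝ) : ∃ r : ℝ, r ^ 3 = x := by
  rcases le_total 0 x with h | h
  · exact ⟨x ^ (((3 : ℕ) : ℝ)⁻¹), Real.rpow_inv_natCast_pow h (by norm_num)⟩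
  · refine ⟨-(-x) ^ (((3 : ℕ) : ℝ)⁻¹), ?_⟩
    have := Real.rpow_inv_natCast_pow (neg_nonneg.2 h) (n := 3) (by norm_num)
    rw [Odd.neg_pow (by decide), this, neg_neg]

/-- The value at the origin is real, so it is the real cube root 1; there f² + f + 1 is 3, so it
stays nonzero nearby. -/
theorem RealGerm.eventually_eq_one_of_cube {f : BaseC → ℂ} (hf : RealGerm f)
    (h : ∀ᶠ s in 𝓝 (0 : BaseC), f s ^ 3 = 1) : ∀ᶠ s in 𝓝 (0 : BaseC), f s = 1 := by
  have h0 : f 0 = 1 := by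
    have h1 := h.self_of_nhds
    rw [hf.value_eq_re] at h1 ⊢
    have h2 : (f 0).re ^ 3 = 1 := by exact_mod_cast h1
    have h3 : (f 0).re = 1 := by
      have : ((f 0).re - 1) * ((f 0).re ^ 2 + (f 0).re + 1) = 0 := by linear_combination h2
      rcases mul_eq_zero.1 this with h | h
      · linarith
      · nlinarith [sq_nonneg ((f 0).re + 1 / 2)]
    rw [h3]; simp
  have h4 : ∀ᶠ s in 𝓝 (0 : BaseC), f s * f s + f s + 1 ≠ 0 :=
    (((hf.mul hf).add hf).add (RealGerm.const (c := 1) (by simp))).eventually_ne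
      (by rw [h0]; norm_num)
  filter_upwards [h, h4] with s h5 h6
  have : (f s - 1) * (f s * f s + f s + 1) = 0 := by linear_combination h5
  rcases mul_eq_zero.1 this with h | h
  · exact sub_eq_zero.1 h
  · exact (h6 h).elim

namespace ConicBundleAction

variable {X : RealConicBundle} {m : ℕ} (α : ConicBundleAction X m)

theorem eventually_mem_base (X : RealConicBundle) : ∀ᶠ s in 𝓝 (0 : BaseC), s ∈ X.S :=
  X.isOpen_S.mem_nhds X.zero_mem

theorem vecGerm_base (k : ZMod m) : VecGerm (α.σ k) := fun i =>
  ⟨(analyticAt_pi_iff (f := fun i s => α.σ k s i)).1 (α.σ_analytic k 0 X.zero_mem) i, by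
    filter_upwards [eventually_mem_base X] with s hs
    rw [α.σ_real k s hs]; rfl⟩

theorem matGerm_fibre (k : ZMod m) : MatGerm (α.A k) :=
  (α.A_analytic k).matGerm (α.A_real k) X.isOpen_S X.zero_mem

theorem matGerm_form (X : RealConicBundle) : MatGerm X.Q :=
  X.analytic.matGerm X.real X.isOpen_S X.zero_mem

/-- The matrices of the action can be rescaled near the origin to an honest cocycle of
determinant one. -/
theorem exists_cocycle (h_zero : ∀ k, α.σ k 0 = 0) :
    ∃ A' : ZMod m → BaseC → Matrix (Fin 3) (Fin 3) ℂ,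
      (∀ k, MatGerm (A' k)) ∧ (∀ k, ∀ᶠ s in 𝓝 (0 : BaseC), (A' k s).det = 1) ∧
      (∀ k, ∀ᶠ s in 𝓝 (0 : BaseC), ∃ c : ℂ, c ≠ 0 ∧ A' k s = c • α.A k s) ∧
      ∀ k l, ∀ᶠ s in 𝓝 (0 : BaseC), A' (k + l) s = A' k (α.σ l s) * A' l s := by
  -- Size three matters: every nonzero real number has a real cube root, so the determinant can be
  -- scaled to one over ℝ. Splitting off its value at the origin puts the rest in the domain of the
  -- principal branch.
  have hu : ∀ k, ∃ u : BaseC → ℂ, RealGerm u ∧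
      ∀ᶠ s in 𝓝 (0 : BaseC), u s ^ 3 * (α.A k s).det = 1 := fun k => by
    have hd := (α.matGerm_fibre k).det
    have hd0 : (α.A k 0).det ≠ 0 := α.A_det k 0 X.zero_mem
    obtain ⟨r, hr⟩ := Real.exists_cube_root (α.A k 0).det.re
    have hr' : (r : ℂ) ^ 3 = (α.A k 0).det := by
      rw [hd.value_eq_re, ← hr]; push_cast; rfl
    have hr0 : (r : ℂ) ≠ 0 := fun h => hd0 (by rw [← hr', h]; simp)
    set f : BaseC → ℂ := fun s => (α.A k s).det * ((r : ℂ) ^ 3)⁻¹ with hf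
    have hf1 : f 0 = 1 := by
      simp only [hf]; rw [hr', mul_inv_cancel₀ hd0]
    have hfg : RealGerm f := hd.mul (by
      have := RealGerm.ofReal ((r ^ 3)⁻¹)
      simpa using this)
    have hc := hfg.cubeRoot hf1
    have hc3 : ∀ s, (f s ^ (((3 : ℕ) : ℂ)⁻¹)) ^ 3 = f s := fun s =>
      Complex.cpow_nat_inv_pow _ (by norm_num)
    have hc0 : f 0 ^ (((3 : ℕ) : ℂ)⁻¹) ≠ 0 := by rw [hf1, Complex.one_cpow]; exact one_ne_zero
    refine ⟨fun s => ((r : ℂ))⁻¹ * (f s ^ (((3 : ℕ) : ℂ)⁻¹))⁻¹,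
      ((RealGerm.ofReal r).inv hr0).mul (hc.inv hc0), ?_⟩
    filter_upwards [hd.eventually_ne hd0] with s hs
    rw [mul_pow, inv_pow, inv_pow, hc3]
    simp only [hf]
    field_simp
  choose u hug hu3 using hu
  have hA' : ∀ k, MatGerm fun s => u k s • α.A k s := fun k =>
    MatGerm.smul (hug k) (α.matGerm_fibre k)
  have hdet : ∀ k, ∀ᶠ s in 𝓝 (0 : BaseC), (u k s • α.A k s).det = 1 := fun k => by
    filter_upwards [hu3 k] with s hs
    rw [Matrix.det_smul]; simpa using hs
  have hne : ∀ k, ∀ᶠ s in 𝓝 (0 : BaseC), u k s ≠ 0 := fun k => by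
    filter_upwards [hu3 k] with s hs h
    rw [h] at hs; simp at hs
  refine ⟨fun k s => u k s • α.A k s, hA', hdet, fun k => ?_, fun k l => ?_⟩
  · filter_upwards [hne k] with s hs
    exact ⟨_, hs, rfl⟩
  have ht := (α.vecGerm_base l).tendsto (h_zero l)
  set N : BaseC → Matrix (Fin 3) (Fin 3) ℂ :=
    fun s => (u k (α.σ l s) • α.A k (α.σ l s)) * (u l s • α.A l s) with hN
  have hNg : MatGerm N := ((hA' k).comp (α.vecGerm_base l) (h_zero l)).mul (hA' l)
  have hNdet : ∀ᶠ s in 𝓝 (0 : BaseC), (N s).det = 1 := by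
    filter_upwards [ht.eventually (hdet k), hdet l] with s h1 h2
    simp only [hN, Matrix.det_mul, h1, h2, mul_one]
  have hN0 : (N 0).det ≠ 0 := by rw [hNdet.self_of_nhds]; exact one_ne_zero
  have hprop : ∀ᶠ s in 𝓝 (0 : BaseC), ∃ c : ℂ, u (k + l) s • α.A (k + l) s = c • N s := by
    filter_upwards [eventually_mem_base X, ht.eventually (hne k), hne l] with s hs h1 h2
    obtain ⟨c, -, hc⟩ := α.A_add k l s hs
    refine ⟨u (k + l) s * c * (u k (α.σ l s))⁻¹ * (u l s)⁻¹, ?_⟩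
    rw [hc]
    simp only [hN, Matrix.smul_mul, Matrix.mul_smul, smul_smul]
    congr 1
    field_simp
  -- The scalar comparing the two sides is only known pointwise; a third of the trace of the
  -- quotient exhibits it as a real germ.
  set τ : BaseC → ℂ :=
    fun s => (3 : ℂ)⁻¹ * ((u (k + l) s • α.A (k + l) s) * (N s)⁻¹).trace with hτ
  have hτg : RealGerm τ :=
    (RealGerm.const (c := (3 : ℂ)⁻¹) (by simp)).mul ((hA' (k + l)).mul (hNg.inv hN0)).trace
  have hτeq : ∀ᶠ s in 𝓝 (0 : BaseC), u (k + l) s • α.A (k + l) s = τ s • N s := by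
    filter_upwards [hprop, hNdet] with s ⟨c, hc⟩ h1
    have : τ s = c := by
      simp only [hτ]
      rw [hc, Matrix.smul_mul, Matrix.mul_nonsing_inv _ (by rw [h1]; exact isUnit_one)]
      simp only [Matrix.trace_smul, Matrix.trace_one, Fintype.card_fin, smul_eq_mul]
      push_cast
      ring
    rw [this, hc]
  have hτ3 : ∀ᶠ s in 𝓝 (0 : BaseC), τ s ^ 3 = 1 := by
    filter_upwards [hτeq, hNdet, hdet (k + l)] with s h1 h2 h3
    rw [h1, Matrix.det_smul, h2] at h3
    simpa using h3
  filter_upwards [hτeq, hτg.eventually_eq_one_of_cube hτ3] with s h1 h2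
  rw [h1, h2, one_smul]

end ConicBundleAction

/-! ### Rotations and roots of unity. -/

theorem fibRot_eq (m j : ℕ) :
    fibRot m j = (rotThree (Complex.exp (2 * Real.pi * Complex.I / m) ^ j)).map Complex.ofReal := by
  have h : Complex.exp (2 * Real.pi * Complex.I / m) ^ j =
      Complex.exp (((2 * Real.pi * j / m : ℝ) : ℂ) * Complex.I) := by
    rw [← Complex.exp_nat_mul]; congr 1; push_cast; ring
  rw [h]
  ext i k
  fin_cases i <;> fin_cases k <;>
    simp [fibRot, rotThree, Complex.exp_ofReal_mul_I_re, Complex.exp_ofReal_mul_I_im,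
      -Complex.ofReal_cos, -Complex.ofReal_sin, -Complex.ofReal_div, -Complex.ofReal_mul]

theorem baseRot_eq (m b j : ℕ) :
    baseRot m b j =
      (rotTwo ((Complex.exp (2 * Real.pi * Complex.I / m) ^ b) ^ j)).map Complex.ofReal := by
  have h : (Complex.exp (2 * Real.pi * Complex.I / m) ^ b) ^ j =
      Complex.exp (((2 * Real.pi * b * j / m : ℝ) : ℂ) * Complex.I) := by
    rw [← Complex.exp_nat_mul, ← Complex.exp_nat_mul]; congr 1; push_cast; ring
  rw [h]
  ext i k
  fin_cases i <;> fin_cases k <;>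
    simp [baseRot, rotTwo, Complex.exp_ofReal_mul_I_re, Complex.exp_ofReal_mul_I_im,
      -Complex.ofReal_cos, -Complex.ofReal_sin, -Complex.ofReal_div, -Complex.ofReal_mul]

theorem map_ofReal_mul {ι κ τ : Type*} [Fintype κ] (M : Matrix ι κ ℝ) (N : Matrix κ τ ℝ) :
    (M * N).map Complex.ofReal = M.map Complex.ofReal * N.map Complex.ofReal :=
  Matrix.map_mul (f := Complex.ofRealHom)

theorem map_ofReal_one {κ : Type*} [DecidableEq κ] :
    (1 : Matrix κ κ ℝ).map Complex.ofReal = 1 :=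
  Matrix.map_one _ Complex.ofReal_zero Complex.ofReal_one

theorem map_ofReal_injective {ι κ : Type*} :
    Function.Injective fun M : Matrix ι κ ℝ => M.map Complex.ofReal :=
  Matrix.map_injective Complex.ofReal_injective

theorem det_map_ofReal {κ : Type*} [Fintype κ] [DecidableEq κ] (M : Matrix κ κ ℝ) :
    (M.map Complex.ofReal).det = (M.det : ℂ) :=
  (RingHom.map_det Complex.ofRealHom M).symm

theorem pow_apply_one_of_add {n : Type*} [Fintype n] [DecidableEq n] {m : ℕ}
    {N : ZMod m → Matrix n n ℝ} (h0 : N 0 = 1) (hadd : ∀ k l, N (k + l) = N k * N l)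
    (g : ZMod m) (j : ℕ) : N (j * g) = N g ^ j := by
  induction j with
  | zero => simp [h0]
  | succ j ih => rw [pow_succ, ← ih, ← hadd]; congr 1; push_cast; ring

/-- Conjugation does not change the order of a matrix, and an injective multiplicative
parametrization transfers that order to the parameter. -/
theorem isPrimitiveRoot_of_conj {n : Type*} [Fintype n] [DecidableEq n] {m : ℕ}
    {rot : ℂ → Matrix n n ℝ} (hinj : Function.Injective rot) (hone : rot 1 = 1)
    (hpow : ∀ z j, rot (z ^ j) = rot z ^ j) {P N : Matrix n n ℝ} (hP : P.det ≠ 0) {z : ℂ}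
    (hz : P * N * P⁻¹ = rot z) (hN : ∀ j : ℕ, N ^ j = 1 ↔ m ∣ j) : IsPrimitiveRoot z m := by
  have key : ∀ j : ℕ, z ^ j = 1 ↔ m ∣ j := fun j => by
    rw [← hN, ← hinj.eq_iff, hone, hpow, ← hz, conj_pow_eq hP]
    constructor
    · intro h
      calc N ^ j = P⁻¹ * (P * N ^ j * P⁻¹) * P := by
            simp only [Matrix.mul_assoc, Matrix.nonsing_inv_mul _ hP.isUnit,
              Matrix.nonsing_inv_mul_cancel_left _ _ hP.isUnit, Matrix.mul_one]
        _ = 1 := by rw [h, Matrix.mul_one, Matrix.nonsing_inv_mul _ hP.isUnit]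
    · intro h
      rw [h, Matrix.mul_one, Matrix.mul_nonsing_inv _ hP.isUnit]
  exact ⟨(key m).2 dvd_rfl, fun j hj => (key j).1 hj⟩

theorem exists_pow_exp_of_isPrimitiveRoot {z : ℂ} {m : ℕ} (hm : m ≠ 0) (hz : IsPrimitiveRoot z m) :
    ∃ a : ℕ, a.Coprime m ∧ z = Complex.exp (2 * Real.pi * Complex.I / m) ^ a := by
  obtain ⟨a, -, ha, h⟩ := (Complex.isPrimitiveRoot_iff z m hm).1 hz
  refine ⟨a, ha, ?_⟩
  rw [← h, ← Complex.exp_nat_mul]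
  congr 1; ring

theorem pow_eq_pow_of_natCast_eq {z : ℂ} {m : ℕ} (hz : IsPrimitiveRoot z m) {a b : ℕ}
    (h : (a : ZMod m) = b) : z ^ a = z ^ b := by
  rw [pow_eq_pow_mod a hz.pow_eq_one, pow_eq_pow_mod b hz.pow_eq_one,
    (ZMod.natCast_eq_natCast_iff a b m).1 h]

/-! ### Linearization of the action on the fibre coordinates. -/

namespace ConicBundleAction

variable {X : RealConicBundle} {m : ℕ} (α : ConicBundleAction X m)

/-- A cocycle of a finite group is conjugate to its value N at the fixed point: the average of N(-k)
A'(k) intertwines the two and is m times the identity at the origin. The constant representation is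
then conjugated to rotations. -/
theorem exists_fibre_linearization (hm : 2 ≤ m) (h_zero : ∀ k, α.σ k 0 = 0)
    (h_real : ∃ p ∈ X.total, p.2 = 0 ∧ IsRealPt p)
    (h_fix : ∀ k : ZMod m, k ≠ 0 → ∀ p ∈ α.fixedPts k, ¬ IsRealPt p) :
    ∃ (g : (ZMod m)ˣ) (B : BaseC → Matrix (Fin 3) (Fin 3) ℂ), MatGerm B ∧ (B 0).det ≠ 0 ∧
      ∀ j : ℕ, ∀ᶠ s in 𝓝 (0 : BaseC), ∃ c : ℂ, c ≠ 0 ∧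
        B (α.σ (j * g) s) * α.A (j * g) s = c • (fibRot m j * B s) := by
  have : NeZero m := ⟨by omega⟩
  obtain ⟨A', hg, hdet, hprop, hadd⟩ := α.exists_cocycle h_zero
  choose N hN using fun k => (hg k).exists_real
  have hNadd : ∀ k l, N (k + l) = N k * N l := fun k l => by
    apply map_ofReal_injective
    have := (hadd k l).self_of_nhds
    rw [h_zero] at this
    simp only [map_ofReal_mul, ← hN, this]
  have hNdet : ∀ k, (N k).det = 1 := fun k => by
    have := (hdet k).self_of_nhds
    rw [hN, det_map_ofReal] at this
    exact_mod_cast this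
  have hN0 : N 0 = 1 := by
    have h1 := hNadd 0 0
    rw [add_zero] at h1
    have h2 : IsUnit (N 0) := (Matrix.isUnit_iff_isUnit_det _).2 (by rw [hNdet]; exact isUnit_one)
    exact h2.mul_left_cancel (by rw [← h1, mul_one])
  have hfaith : ∀ k, N k = 1 → k = 0 := fun k hk => by
    by_contra hk0
    obtain ⟨p, hp, hp0, hpr⟩ := h_real
    refine h_fix k hk0 p ⟨hp, by rw [hp0, h_zero], ?_⟩ hpr
    obtain ⟨c, hc0, hc⟩ := (hprop k).self_of_nhds
    rw [hN, hk, map_ofReal_one] at hc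
    refine ⟨c⁻¹, ?_⟩
    have : α.A k 0 = c⁻¹ • (1 : Matrix (Fin 3) (Fin 3) ℂ) := by
      rw [hc, smul_smul, inv_mul_cancel₀ hc0, one_smul]
    rw [hp0, this, Matrix.smul_mulVec, Matrix.one_mulVec]
  have hNpow : ∀ j : ℕ, N 1 ^ j = N j := fun j => by
    rw [← pow_apply_one_of_add hN0 hNadd, mul_one]
  have hNone : ∀ j : ℕ, N 1 ^ j = 1 ↔ m ∣ j := fun j => by
    rw [hNpow, ← ZMod.natCast_eq_zero_iff]
    exact ⟨fun h => hfaith _ h, fun h => by rw [h, hN0]⟩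
  obtain ⟨P, z, hP, hz⟩ := exists_conj_rotThree (N 1) (by omega) ((hNone m).2 dvd_rfl) (hNdet 1)
  have hzp : IsPrimitiveRoot z m :=
    isPrimitiveRoot_of_conj rotThree_injective rotThree_one rotThree_pow hP hz hNone
  obtain ⟨a, ha, hza⟩ := exists_pow_exp_of_isPrimitiveRoot (by omega) hzp
  set ζ := Complex.exp (2 * Real.pi * Complex.I / m) with hζ
  have hζp : IsPrimitiveRoot ζ m := Complex.isPrimitiveRoot_exp m (by omega)
  -- The class of 1 rotates by 2πa/m; its multiple by the inverse of a rotates by 2π/m.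
  set g : (ZMod m)ˣ := (ZMod.unitOfCoprime a ha)⁻¹ with hgdef
  have hga : (a : ZMod m) * (g : ZMod m) = 1 := by
    rw [hgdef, ← ZMod.coe_unitOfCoprime a ha, Units.mul_inv]
  have hrot : ∀ j : ℕ, P * N (j * g) * P⁻¹ = rotThree (ζ ^ j) := fun j => by
    have h1 : ((j * (g : ZMod m).val : ℕ) : ZMod m) = j * g := by
      push_cast; rw [ZMod.natCast_zmod_val]
    rw [← h1, ← hNpow, ← conj_pow_eq hP, hz, ← rotThree_pow, hza, ← pow_mul]
    congr 1
    refine pow_eq_pow_of_natCast_eq hζp ?_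
    push_cast
    rw [ZMod.natCast_zmod_val]
    linear_combination (j : ZMod m) * hga
  set B₀ : BaseC → Matrix (Fin 3) (Fin 3) ℂ :=
    fun s => ∑ k : ZMod m, (N (-k)).map Complex.ofReal * A' k s with hB₀
  have hB₀g : MatGerm B₀ := MatGerm.sum _ fun k _ => (MatGerm.ofReal _).mul (hg k)
  have hB₀0 : B₀ 0 = (m : ℂ) • (1 : Matrix (Fin 3) (Fin 3) ℂ) := by
    have : ∀ k : ZMod m, (N (-k)).map Complex.ofReal * A' k 0 = 1 := fun k => by
      rw [hN, ← map_ofReal_mul, ← hNadd, neg_add_cancel, hN0, map_ofReal_one]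
    simp only [hB₀, this]
    rw [Finset.sum_const, Finset.card_univ, ZMod.card, Nat.cast_smul_eq_nsmul]
  have hB₀eq : ∀ l, ∀ᶠ s in 𝓝 (0 : BaseC),
      B₀ (α.σ l s) * A' l s = (N l).map Complex.ofReal * B₀ s := fun l => by
    filter_upwards [eventually_all.2 fun k => hadd k l] with s hs
    simp only [hB₀, Finset.sum_mul, Finset.mul_sum, Matrix.mul_assoc, ← hs]
    rw [← Equiv.sum_comp (Equiv.addRight l) fun k =>
      (N l).map Complex.ofReal * ((N (-k)).map Complex.ofReal * A' k s)]
    refine Finset.sum_congr rfl fun k _ => ?_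
    rw [← Matrix.mul_assoc, ← map_ofReal_mul, ← hNadd]
    simp
  refine ⟨g, fun s => P.map Complex.ofReal * B₀ s, (MatGerm.ofReal P).mul hB₀g, ?_, fun j => ?_⟩
  · rw [Matrix.det_mul, det_map_ofReal, hB₀0, Matrix.det_smul]
    simp [hP, NeZero.ne m]
  · filter_upwards [hB₀eq (j * g), hprop (j * g)] with s h1 ⟨c, hc0, hc⟩
    refine ⟨c⁻¹, inv_ne_zero hc0, ?_⟩
    have h2 : α.A (j * g) s = c⁻¹ • A' (j * g) s := by
      rw [hc, smul_smul, inv_mul_cancel₀ hc0, one_smul]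
    rw [h2, Matrix.mul_smul, Matrix.mul_assoc, h1, fibRot_eq, ← hζ, ← hrot,
      ← Matrix.mul_assoc, ← map_ofReal_mul, ← Matrix.mul_assoc, ← map_ofReal_mul,
      Matrix.mul_assoc (P * N (j * g)), Matrix.nonsing_inv_mul _ hP.isUnit, Matrix.mul_one]

end ConicBundleAction

/-! ### Invariant completion of the square. -/

theorem quadVal_transpose_mul_mul (M C : Matrix (Fin 3) (Fin 3) ℂ) (v : FibC) :
    quadVal (C.transpose * M * C) v = quadVal M (C.mulVec v) := by
  unfold quadVal
  rw [← Matrix.mulVec_mulVec, ← Matrix.mulVec_mulVec, Matrix.dotProduct_mulVec,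
    Matrix.vecMul_transpose]

theorem quadVal_smul_right (M : Matrix (Fin 3) (Fin 3) ℂ) (c : ℂ) (v : FibC) :
    quadVal M (c • v) = c ^ 2 * quadVal M v := by
  simp only [quadVal, Matrix.mulVec_smul, dotProduct_smul, smul_dotProduct, smul_eq_mul]
  ring

theorem quadVal_smul_left (M : Matrix (Fin 3) (Fin 3) ℂ) (c : ℂ) (v : FibC) :
    quadVal (c • M) v = c * quadVal M v := by
  simp only [quadVal, Matrix.smul_mulVec, dotProduct_smul, smul_eq_mul]

theorem quadVal_single (M : Matrix (Fin 3) (Fin 3) ℂ) (i : Fin 3) :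
    quadVal M (Pi.single i 1) = M i i := by
  simp [quadVal]

theorem eq_of_quadVal_eq {M N : Matrix (Fin 3) (Fin 3) ℂ} (hM : M.IsSymm) (hN : N.IsSymm)
    (h : ∀ v, quadVal M v = quadVal N v) : M = N := by
  ext i j
  have h1 := h (Pi.single i 1)
  have h2 := h (Pi.single j 1)
  have h3 := h (Pi.single i 1 + Pi.single j 1)
  rw [quadVal_single, quadVal_single] at h1 h2
  simp only [quadVal, Matrix.mulVec_add, dotProduct_add, add_dotProduct, Matrix.mulVec_single_one,
    single_one_dotProduct, Matrix.col_apply] at h3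
  have h4 := hM.apply i j
  have h5 := hN.apply i j
  rw [h1, h2, h4, h5] at h3
  linear_combination h3 / 2

theorem fibRot_shape (m j : ℕ) :
    ∃ p q : ℂ, p ^ 2 + q ^ 2 = 1 ∧ fibRot m j = !![p, q, 0; -q, p, 0; 0, 0, 1] :=
  ⟨(Real.cos (2 * Real.pi * j / m) : ℂ), (Real.sin (2 * Real.pi * j / m) : ℂ), by
    exact_mod_cast Real.cos_sq_add_sin_sq _, rfl⟩

/-- The matrix of the quadratic form `z² + a x² + 2 b x y + c y²`. -/
def blockForm (a b c : ℂ) : Matrix (Fin 3) (Fin 3) ℂ := !![a, b, 0; b, c, 0; 0, 0, 1]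

theorem quadVal_blockForm (a b c : ℂ) (v : FibC) :
    quadVal (blockForm a b c) v =
      v 2 ^ 2 + a * v 0 ^ 2 + 2 * b * v 0 * v 1 + c * v 1 ^ 2 := by
  simp [quadVal, blockForm, Matrix.mulVec, dotProduct, Fin.sum_univ_three]
  ring

theorem blockForm_isSymm (a b c : ℂ) : (blockForm a b c).IsSymm := by
  ext i j
  fin_cases i <;> fin_cases j <;> rfl

/-- The elementary matrix that adds `p x + q y` to the coordinate `z`. -/
def shear (p q : ℂ) : Matrix (Fin 3) (Fin 3) ℂ := !![1, 0, 0; 0, 1, 0; p, q, 1]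

theorem det_shear (p q : ℂ) : (shear p q).det = 1 := by
  simp [shear, Matrix.det_fin_three]

/-- Completing the square. -/
theorem transpose_shear_mul_blockForm_mul_shear {E : Matrix (Fin 3) (Fin 3) ℂ} (hE : E.IsSymm)
    (h : E 2 2 = 1) :
    (shear (E 2 0) (E 2 1)).transpose * blockForm (E 0 0 - E 2 0 * E 2 0)
      (E 0 1 - E 2 0 * E 2 1) (E 1 1 - E 2 1 * E 2 1) * shear (E 2 0) (E 2 1) = E := by
  have h01 := hE.apply 0 1
  have h02 := hE.apply 0 2
  have h12 := hE.apply 1 2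
  ext i j
  fin_cases i <;> fin_cases j <;>
    simp [shear, blockForm, Matrix.mul_apply, Fin.sum_univ_three, h01, h02, h12, h]
  all_goals ring

theorem eq_of_conj_eq {n : Type*} [Fintype n] [DecidableEq n] {T M N : Matrix n n ℂ}
    (hT : T.det ≠ 0) (h : T.transpose * M * T = T.transpose * N * T) : M = N := by
  have hT' : T.transpose.det ≠ 0 := by rwa [Matrix.det_transpose]
  have key : ∀ K : Matrix n n ℂ, T.transpose⁻¹ * (T.transpose * K * T) * T⁻¹ = K := fun K => by
    rw [Matrix.mul_assoc T.transpose, Matrix.nonsing_inv_mul_cancel_left _ _ hT'.isUnit,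
      Matrix.mul_assoc, Matrix.mul_nonsing_inv _ hT.isUnit, Matrix.mul_one]
  rw [← key M, h, key]

/-- Invariance of a family of forms passes to its pullback under a change of coordinates that
intertwines the action; this is applied with T the shear that completes the square. -/
theorem transpose_mul_mul_eq_of_intertwine {n : Type*} [Fintype n] [DecidableEq n]
    {R T T' K K' D D' : Matrix n n ℂ} (hT : T.det ≠ 0) (h : T.transpose * K * T = D)
    (h' : T'.transpose * K' * T' = D') (hR : T' * R = R * T) (hD : R.transpose * D' * R = D) :
    R.transpose * K' * R = K := by
  refine eq_of_conj_eq hT ?_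
  have h5 := congrArg Matrix.transpose hR
  rw [Matrix.transpose_mul, Matrix.transpose_mul] at h5
  rw [h, ← hD, ← h']
  simp only [← Matrix.mul_assoc]
  rw [← h5]
  simp only [Matrix.mul_assoc]
  rw [hR]

namespace ConicBundleAction

variable {X : RealConicBundle} {m : ℕ} (α : ConicBundleAction X m)

/-- This turns linear algebra into fixed points of Y: over a fixed point of the base, an eigenvector
of the normalized matrix that lies on the conic is a fixed point. -/
theorem mem_fixedPts_of_eigenvector {g : ZMod m} {B F : BaseC → Matrix (Fin 3) (Fin 3) ℂ}
    {s : BaseC} {R : Matrix (Fin 3) (Fin 3) ℂ} {v : FibC} {e l : ℂ} (hs : s ∈ X.S) (hσ : α.σ g s = s)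
    (hB : (B s).det ≠ 0) (hBA : ∃ c : ℂ, c ≠ 0 ∧ B (α.σ g s) * α.A g s = c • (R * B s))
    (hF : ∀ v, quadVal (F s) ((B s).mulVec v) = e * quadVal (X.Q s) v) (he : e ≠ 0)
    (hv : v ≠ 0) (hRv : R.mulVec v = l • v) (hFv : quadVal (F s) v = 0) :
    ((B s)⁻¹.mulVec v, s) ∈ α.fixedPts g := by
  have hcancel : (B s).mulVec ((B s)⁻¹.mulVec v) = v := by
    rw [Matrix.mulVec_mulVec, Matrix.mul_nonsing_inv _ hB.isUnit, Matrix.one_mulVec]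
  refine ⟨⟨fun h => hv ?_, hs, ?_⟩, hσ, ?_⟩
  · rw [← hcancel]
    simp only at h
    rw [h, Matrix.mulVec_zero]
  · have := hF ((B s)⁻¹.mulVec v)
    rw [hcancel, hFv] at this
    exact (mul_eq_zero.1 this.symm).resolve_left he
  · obtain ⟨c, -, hc⟩ := hBA
    rw [hσ] at hc
    refine ⟨c * l, ?_⟩
    have : α.A g s = (B s)⁻¹ * (c • (R * B s)) := by
      rw [← hc, Matrix.nonsing_inv_mul_cancel_left _ _ hB.isUnit]
    simp only
    rw [this, ← Matrix.mulVec_mulVec, Matrix.smul_mulVec, ← Matrix.mulVec_mulVec, hcancel, hRv,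
      smul_smul, Matrix.mulVec_smul]

theorem isRealPt_inv_mulVec {B : BaseC → Matrix (Fin 3) (Fin 3) ℂ} (hB : MatGerm B)
    (hB0 : (B 0).det ≠ 0) {v : FibC} (hv : star v = v) : IsRealPt ((B 0)⁻¹.mulVec v, 0) := by
  refine ⟨star_zero _, 1, ?_⟩
  rw [one_smul]
  have h1 : ∀ i j, star ((B 0)⁻¹ i j) = (B 0)⁻¹ i j := fun i j => ((hB.inv hB0) i j).star_value
  have h2 : ∀ i, star (v i) = v i := congrFun hv
  ext i
  change star ((B 0)⁻¹.mulVec v i) = (B 0)⁻¹.mulVec v i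
  simp only [Matrix.mulVec, dotProduct, star_sum, star_mul', h1, h2]

/-- In the fibre coordinates `B` the action of the generator `g` is linear near the origin, and the
equation, multiplied by `e`, is the sum of `z²` and an invariant family of binary forms. -/
structure IsBlockForm (g : (ZMod m)ˣ) (B : BaseC → Matrix (Fin 3) (Fin 3) ℂ)
    (a b c e : BaseC → ℂ) : Prop where
  matGerm : MatGerm B
  det_ne : (B 0).det ≠ 0
  germ_a : RealGerm a
  germ_b : RealGerm b
  germ_c : RealGerm c
  germ_e : RealGerm e
  e_ne : e 0 ≠ 0
  linear : ∀ j : ℕ, ∀ᶠ s in 𝓝 (0 : BaseC), ∃ c : ℂ, c ≠ 0 ∧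
    B (α.σ (j * g) s) * α.A (j * g) s = c • (fibRot m j * B s)
  equation : ∀ᶠ s in 𝓝 (0 : BaseC), ∀ v,
    quadVal (blockForm (a s) (b s) (c s)) ((B s).mulVec v) = e s * quadVal (X.Q s) v
  invariant : ∀ j : ℕ, ∀ᶠ s in 𝓝 (0 : BaseC), (fibRot m j).transpose *
    blockForm (a (α.σ (j * g) s)) (b (α.σ (j * g) s)) (c (α.σ (j * g) s)) * fibRot m j =
      blockForm (a s) (b s) (c s)

theorem exists_isBlockForm (hm : 2 ≤ m) (h_zero : ∀ k, α.σ k 0 = 0)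
    (h_fix : ∀ k : ZMod m, k ≠ 0 → ∀ p ∈ α.fixedPts k, ¬ IsRealPt p) {g : (ZMod m)ˣ}
    {B : BaseC → Matrix (Fin 3) (Fin 3) ℂ} (hB : MatGerm B) (hB0 : (B 0).det ≠ 0)
    (hBA : ∀ j : ℕ, ∀ᶠ s in 𝓝 (0 : BaseC), ∃ c : ℂ, c ≠ 0 ∧
        B (α.σ (j * g) s) * α.A (j * g) s = c • (fibRot m j * B s)) :
    ∃ (B' : BaseC → Matrix (Fin 3) (Fin 3) ℂ) (a b c e : BaseC → ℂ),
      α.IsBlockForm g B' a b c e := by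
  have : Fact (1 < m) := ⟨by omega⟩
  set E : BaseC → Matrix (Fin 3) (Fin 3) ℂ := fun s => (B s)⁻¹.transpose * X.Q s * (B s)⁻¹ with hE
  have hEg : MatGerm E := ((hB.inv hB0).transpose.mul (matGerm_form X)).mul (hB.inv hB0)
  have hEq : ∀ s v, quadVal (E s) v = quadVal (X.Q s) ((B s)⁻¹.mulVec v) := fun s v =>
    quadVal_transpose_mul_mul _ _ _
  have hEB : ∀ s, (B s).det ≠ 0 → ∀ v, quadVal (E s) ((B s).mulVec v) = 1 * quadVal (X.Q s) v :=
    fun s hs v => by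
      rw [hEq, Matrix.mulVec_mulVec, Matrix.nonsing_inv_mul _ hs.isUnit, Matrix.one_mulVec, one_mul]
  have hEsymm : ∀ s ∈ X.S, (E s).IsSymm := fun s hs => by
    unfold Matrix.IsSymm
    simp only [hE, Matrix.transpose_mul, Matrix.transpose_transpose, Matrix.mul_assoc,
      (X.symm s hs).eq]
  have hrotz : ∀ j : ℕ, (fibRot m j).mulVec (Pi.single 2 1) = Pi.single 2 1 := fun j => by
    obtain ⟨p, q, -, h⟩ := fibRot_shape m j
    rw [h]
    ext i; fin_cases i <;> simp
  -- Otherwise the axis (0:0:1) would be a real fixed point on the central conic.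
  have hε0 : E 0 2 2 ≠ 0 := fun h => by
    have h1 := α.mem_fixedPts_of_eigenvector (g := g) (F := E) (R := fibRot m 1) (l := 1) (e := 1)
      (v := Pi.single 2 1)
      X.zero_mem (h_zero g) hB0 (by simpa using (hBA 1).self_of_nhds) (hEB 0 hB0) one_ne_zero
      (by simp) (by rw [hrotz, one_smul]) (by rw [quadVal_single, h])
    refine h_fix g g.ne_zero _ h1 (isRealPt_inv_mulVec hB hB0 ?_)
    ext i; fin_cases i <;> simp
  have hequiv : ∀ j : ℕ, ∀ᶠ s in 𝓝 (0 : BaseC), ∃ c : ℂ, c ≠ 0 ∧ ∀ v,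
      quadVal (E (α.σ (j * g) s)) ((fibRot m j).mulVec v) = c * quadVal (E s) v := fun j => by
    have ht := (α.vecGerm_base (j * g)).tendsto (h_zero _)
    filter_upwards [eventually_mem_base X, hBA j, hB.eventually_det_ne hB0,
      ht.eventually (hB.eventually_det_ne hB0)] with s hs ⟨c, hc0, hc⟩ hd hd'
    obtain ⟨e, he0, he⟩ := α.preserves (j * g) s hs
    refine ⟨e * (c⁻¹) ^ 2, by positivity, fun v => ?_⟩
    have h1 : (B (α.σ (j * g) s))⁻¹.mulVec ((fibRot m j).mulVec v) =
        c⁻¹ • (α.A (j * g) s).mulVec ((B s)⁻¹.mulVec v) := by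
      have h2 : fibRot m j = c⁻¹ • (B (α.σ (j * g) s) * α.A (j * g) s * (B s)⁻¹) := by
        rw [hc, Matrix.smul_mul, smul_smul, inv_mul_cancel₀ hc0, one_smul, Matrix.mul_assoc,
          Matrix.mul_nonsing_inv _ hd.isUnit, Matrix.mul_one]
      rw [h2, Matrix.smul_mulVec, Matrix.mulVec_smul, Matrix.mulVec_mulVec, Matrix.mul_assoc,
        Matrix.nonsing_inv_mul_cancel_left _ _ hd'.isUnit, Matrix.mulVec_mulVec]
    rw [hEq, h1, quadVal_smul_right, he, hEq]
    ring
  set D : BaseC → Matrix (Fin 3) (Fin 3) ℂ := fun s => (E s 2 2)⁻¹ • E s with hD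
  have hDg : MatGerm D := MatGerm.smul ((hEg 2 2).inv hε0) hEg
  have hDsymm : ∀ s ∈ X.S, (D s).IsSymm := fun s hs => (hEsymm s hs).smul _
  have hD22 : ∀ᶠ s in 𝓝 (0 : BaseC), D s 2 2 = 1 := by
    filter_upwards [(hEg 2 2).eventually_ne hε0] with s hs
    simp [hD, hs]
  -- Evaluating on the axis vector, which the rotation fixes exactly, identifies the scalar c;
  -- dividing by the coefficient of z² cancels it.
  have hDequiv : ∀ j : ℕ, ∀ᶠ s in 𝓝 (0 : BaseC),
      (fibRot m j).transpose * D (α.σ (j * g) s) * fibRot m j = D s := fun j => by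
    have ht := (α.vecGerm_base (j * g)).tendsto (h_zero _)
    filter_upwards [eventually_mem_base X, hequiv j, (hEg 2 2).eventually_ne hε0] with
      s hs ⟨c, hc0, hc⟩ hne
    have hs' := α.σ_mapsTo (j * g) hs
    refine eq_of_quadVal_eq ?_ (hDsymm s hs) fun v => ?_
    · unfold Matrix.IsSymm
      simp only [Matrix.transpose_mul, Matrix.transpose_transpose, Matrix.mul_assoc,
        (hDsymm _ hs').eq]
    · have h1 := hc (Pi.single 2 1)
      rw [hrotz, quadVal_single, quadVal_single] at h1
      rw [quadVal_transpose_mul_mul]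
      simp only [hD, quadVal_smul_left, hc, h1]
      field_simp
  set T : BaseC → Matrix (Fin 3) (Fin 3) ℂ := fun s => shear (D s 2 0) (D s 2 1) with hT
  have hTg : MatGerm T := fun i j => by
    fin_cases i <;> fin_cases j
    · exact RealGerm.const (c := 1) (by simp)
    · exact RealGerm.const (c := 0) (by simp)
    · exact RealGerm.const (c := 0) (by simp)
    · exact RealGerm.const (c := 0) (by simp)
    · exact RealGerm.const (c := 1) (by simp)
    · exact RealGerm.const (c := 0) (by simp)
    · exact hDg 2 0
    · exact hDg 2 1
    · exact RealGerm.const (c := 1) (by simp)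
  -- The last row of the invariance relation says that the linear form multiplying z is itself
  -- invariant, so the shear is equivariant.
  have hTequiv : ∀ j : ℕ, ∀ᶠ s in 𝓝 (0 : BaseC),
      T (α.σ (j * g) s) * fibRot m j = fibRot m j * T s := fun j => by
    filter_upwards [hDequiv j] with s hs
    obtain ⟨p, q, -, hpq⟩ := fibRot_shape m j
    have h0 := congrFun (congrFun hs 2) 0
    have h1 := congrFun (congrFun hs 2) 1
    rw [hpq] at h0 h1 ⊢
    simp [Matrix.mul_apply, Fin.sum_univ_three] at h0 h1
    ext i k
    fin_cases i <;> fin_cases k <;>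
      simp [hT, shear, Matrix.mul_apply, Fin.sum_univ_three, ← h0, ← h1]
  have hblock : ∀ᶠ s in 𝓝 (0 : BaseC), (T s).transpose *
      blockForm (D s 0 0 - D s 2 0 * D s 2 0) (D s 0 1 - D s 2 0 * D s 2 1)
        (D s 1 1 - D s 2 1 * D s 2 1) * T s = D s := by
    filter_upwards [eventually_mem_base X, hD22] with s hs h1
    exact transpose_shear_mul_blockForm_mul_shear (hDsymm s hs) h1
  refine ⟨fun s => T s * B s, fun s => D s 0 0 - D s 2 0 * D s 2 0,
    fun s => D s 0 1 - D s 2 0 * D s 2 1, fun s => D s 1 1 - D s 2 1 * D s 2 1,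
    fun s => (E s 2 2)⁻¹, hTg.mul hB, ?_, (hDg 0 0).sub ((hDg 2 0).mul (hDg 2 0)),
    (hDg 0 1).sub ((hDg 2 0).mul (hDg 2 1)),
    (hDg 1 1).sub ((hDg 2 1).mul (hDg 2 1)), (hEg 2 2).inv hε0,
    inv_ne_zero hε0, fun j => ?_, ?_, fun j => ?_⟩
  · rw [Matrix.det_mul, det_shear, one_mul]; exact hB0
  · filter_upwards [hBA j, hTequiv j] with s ⟨c, hc0, hc⟩ h1
    refine ⟨c, hc0, ?_⟩
    rw [Matrix.mul_assoc, hc, Matrix.mul_smul, ← Matrix.mul_assoc, h1, Matrix.mul_assoc]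
  · filter_upwards [hblock, hB.eventually_det_ne hB0] with s h1 hd v
    rw [← Matrix.mulVec_mulVec, ← quadVal_transpose_mul_mul, h1]
    simp only [hD]
    rw [quadVal_smul_left, hEB s hd, one_mul]
  · have ht := (α.vecGerm_base (j * g)).tendsto (h_zero _)
    filter_upwards [hblock, ht.eventually hblock, hTequiv j, hDequiv j] with s h1 h2 h3 h4
    exact transpose_mul_mul_eq_of_intertwine (by rw [det_shear]; exact one_ne_zero) h1 h2 h3 h4

end ConicBundleAction

/-! ### The binary form over the origin. -/

theorem fibRot_sin_ne_zero {m : ℕ} (hm : 3 ≤ m) : Real.sin (2 * Real.pi * (1 : ℕ) / m) ≠ 0 := by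
  have hm' : (3 : ℝ) ≤ m := by exact_mod_cast hm
  have hpi := Real.pi_pos
  refine (Real.sin_pos_of_pos_of_lt_pi (by positivity) ?_).ne'
  rw [div_lt_iff₀ (by linarith)]
  push_cast
  nlinarith

theorem fibRot_half {m r : ℕ} (hr : m = r + r) (h0 : r ≠ 0) :
    fibRot m r = !![-1, 0, 0; 0, -1, 0; 0, 0, 1] := by
  have h : 2 * Real.pi * (r : ℝ) / (m : ℝ) = Real.pi := by
    have : (r : ℝ) ≠ 0 := by exact_mod_cast h0
    rw [hr]; push_cast; field_simp; ring
  simp only [fibRot, h]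
  simp

theorem natCast_mul_unit_ne_zero {m j : ℕ} (g : (ZMod m)ˣ) (h0 : 0 < j) (hj : j < m) :
    (j : ZMod m) * g ≠ 0 := by
  intro h
  rw [Units.mul_left_eq_zero, ZMod.natCast_eq_zero_iff] at h
  exact absurd (Nat.le_of_dvd h0 h) (by omega)

/-- Since p² + q² = 1, both relations are divisible by q; what is left is a linear system in b and a
- c whose determinant is nonzero for the same reason. -/
theorem eq_of_rotation_invariant {p q a b c : ℂ} (hpq : p ^ 2 + q ^ 2 = 1) (hq : q ≠ 0)
    (h00 : p * (p * a) - p * (q * b) - q * (p * b) + q * (q * c) = a)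
    (h01 : q * (p * a) - q * (q * b) + p * (p * b) - p * (q * c) = b) : b = 0 ∧ a = c := by
  have h1 : q * (c - a) = 2 * p * b := mul_left_cancel₀ hq (by linear_combination h00 - a * hpq)
  have h2 : p * (a - c) = 2 * q * b := mul_left_cancel₀ hq (by linear_combination h01 - b * hpq)
  constructor
  · linear_combination (-b) * hpq - p / 2 * h1 - q / 2 * h2
  · linear_combination (c - a) * hpq + p * h2 - q * h1

theorem exists_real_zero_of_disc_nonpos {a b c : ℝ} (h : a * c - b ^ 2 ≤ 0) :
    ∃ x y : ℝ, (x ≠ 0 ∨ y ≠ 0) ∧ a * x ^ 2 + 2 * b * x * y + c * y ^ 2 = 0 := by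
  by_cases ha : a = 0
  · exact ⟨1, 0, Or.inl one_ne_zero, by simp [ha]⟩
  -- The quadratic formula in homogeneous form.
  · refine ⟨-b + Real.sqrt (b ^ 2 - a * c), a, Or.inr ha, ?_⟩
    have := Real.sq_sqrt (show 0 ≤ b ^ 2 - a * c by linarith)
    linear_combination a * this

/-- The sum of v and its conjugate is (1 + c)v, which is real; if it vanishes, then v is purely
imaginary and iv is real. -/
theorem exists_real_multiple {v : FibC} (h : ∃ c : ℂ, star v = c • v) :
    ∃ l : ℂ, l ≠ 0 ∧ star (l • v) = l • v := by
  obtain ⟨c, hc⟩ := h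
  by_cases h1 : 1 + c = 0
  · refine ⟨Complex.I, Complex.I_ne_zero, ?_⟩
    have : c = -1 := by linear_combination h1
    rw [star_smul, hc, this]
    simp
  · refine ⟨1 + c, h1, ?_⟩
    have h2 : (star c * c) • v = v := by
      have := congrArg star hc
      rw [star_star, star_smul, hc, smul_smul] at this
      exact this.symm
    rw [star_smul, hc, smul_smul]
    have h3 : star (1 + c) * c = c + star c * c := by simp [add_mul]
    rw [h3, add_smul, h2, add_smul, one_smul, add_comm]

namespace ConicBundleAction.IsBlockForm

variable {X : RealConicBundle} {m : ℕ} {α : ConicBundleAction X m} {g : (ZMod m)ˣ}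
  {B : BaseC → Matrix (Fin 3) (Fin 3) ℂ} {a b c e : BaseC → ℂ}

theorem eventually_fixed (H : α.IsBlockForm g B a b c e) (j : ℕ) :
    ∀ᶠ s in 𝓝 (0 : BaseC), α.σ (j * g) s = s → ∀ (v : FibC) (l : ℂ), v ≠ 0 →
      (fibRot m j).mulVec v = l • v → quadVal (blockForm (a s) (b s) (c s)) v = 0 →
      ((B s)⁻¹.mulVec v, s) ∈ α.fixedPts (j * g) := by
  filter_upwards [eventually_mem_base X, H.matGerm.eventually_det_ne H.det_ne, H.linear j,
    H.equation, H.germ_e.eventually_ne H.e_ne] with s h1 h2 h3 h4 h5 hσ v l hv hl hF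
  exact α.mem_fixedPts_of_eigenvector (F := fun s => blockForm (a s) (b s) (c s)) h1 hσ h2 h3 h4 h5
    hv hl hF

theorem invariant_entries (H : α.IsBlockForm g B a b c e) (j : ℕ) :
    ∀ᶠ s in 𝓝 (0 : BaseC), ∀ p q : ℂ, fibRot m j = !![p, q, 0; -q, p, 0; 0, 0, 1] →
      p * (p * a (α.σ (j * g) s)) - p * (q * b (α.σ (j * g) s)) - q * (p * b (α.σ (j * g) s)) +
        q * (q * c (α.σ (j * g) s)) = a s ∧
      q * (p * a (α.σ (j * g) s)) - q * (q * b (α.σ (j * g) s)) + p * (p * b (α.σ (j * g) s)) -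
        p * (q * c (α.σ (j * g) s)) = b s ∧
      q * (q * a (α.σ (j * g) s)) + p * (q * b (α.σ (j * g) s)) + q * (p * b (α.σ (j * g) s)) +
        p * (p * c (α.σ (j * g) s)) = c s := by
  filter_upwards [H.invariant j] with s hs p q hpq
  rw [hpq] at hs
  have h00 := congrFun (congrFun hs 0) 0
  have h01 := congrFun (congrFun hs 0) 1
  have h11 := congrFun (congrFun hs 1) 1
  simp [blockForm, Matrix.mul_apply, Fin.sum_univ_three] at h00 h01 h11
  exact ⟨by linear_combination h00, by linear_combination h01, by linear_combination h11⟩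

/-- For `m ≥ 3` the binary form over the origin is a multiple of `x² + y²`. -/
theorem scalar_at_zero (H : α.IsBlockForm g B a b c e) (h_zero : ∀ k, α.σ k 0 = 0) (hm : 3 ≤ m) :
    b 0 = 0 ∧ a 0 = c 0 := by
  obtain ⟨h00, h01, -⟩ := (H.invariant_entries 1).self_of_nhds _ _ rfl
  rw [h_zero] at h00 h01
  refine eq_of_rotation_invariant (by exact_mod_cast Real.cos_sq_add_sin_sq _) ?_ h00 h01
  exact_mod_cast fibRot_sin_ne_zero hm

/-- For even `m` the binary form over the origin is definite. -/
theorem disc_pos_of_even (H : α.IsBlockForm g B a b c e) (h_zero : ∀ k, α.σ k 0 = 0) (hm : 2 ≤ m)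
    (h_fix : ∀ k : ZMod m, k ≠ 0 → ∀ p ∈ α.fixedPts k, ¬ IsRealPt p) (he : Even m) :
    0 < (a 0).re * (c 0).re - (b 0).re ^ 2 := by
  by_contra! hneg
  obtain ⟨x, y, hxy, h⟩ := exists_real_zero_of_disc_nonpos hneg
  obtain ⟨r, hr⟩ := he
  have hv0 : (![(x : ℂ), (y : ℂ), 0] : FibC) ≠ 0 := fun h => by
    have h0 := congrFun h 0
    have h1 := congrFun h 1
    simp at h0 h1
    tauto
  -- The half turn fixes every point of the line z = 0, so a real zero of the binary form would be a
  -- real fixed point.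
  have hmem := (H.eventually_fixed r).self_of_nhds (h_zero _) ![(x : ℂ), (y : ℂ), 0] (-1) hv0
    (by
      rw [fibRot_half hr (by omega)]
      ext i; fin_cases i <;> simp [Matrix.mulVec, dotProduct, Fin.sum_univ_three])
    (by
      rw [quadVal_blockForm, H.germ_a.value_eq_re, H.germ_b.value_eq_re, H.germ_c.value_eq_re]
      simp
      exact_mod_cast h)
  refine h_fix _ (natCast_mul_unit_ne_zero g (by omega) (by omega)) _ hmem
    (isRealPt_inv_mulVec H.matGerm H.det_ne ?_)
  ext i; fin_cases i <;> simp

theorem exists_real_zero (H : α.IsBlockForm g B a b c e)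
    (h_real : ∃ p ∈ X.total, p.2 = 0 ∧ IsRealPt p) :
    ∃ x y z : ℝ, (x ≠ 0 ∨ y ≠ 0 ∨ z ≠ 0) ∧
      z ^ 2 + (a 0).re * x ^ 2 + 2 * (b 0).re * x * y + (c 0).re * y ^ 2 = 0 := by
  obtain ⟨p, ⟨hp1, -, hp3⟩, hp0, -, hpr⟩ := h_real
  obtain ⟨l, hl0, hl⟩ := exists_real_multiple hpr
  set u := (B 0).mulVec (l • p.1) with hu
  have hBr : ∀ i j, star (B 0 i j) = B 0 i j := fun i j => (H.matGerm i j).star_value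
  have hur : ∀ i, u i = ((u i).re : ℂ) := fun i => by
    have h1 : star (u i) = u i := by
      have h2 : ∀ k, star ((l • p.1) k) = (l • p.1) k := congrFun hl
      simp only [hu, Matrix.mulVec, dotProduct, star_sum, star_mul', hBr, h2]
    exact (Complex.conj_eq_iff_re.1 h1).symm
  have hu0 : u ≠ 0 := fun h => by
    have h1 : l • p.1 = 0 := by
      by_contra h2
      exact H.det_ne (Matrix.exists_mulVec_eq_zero_iff.1 ⟨_, h2, h⟩)
    exact (smul_ne_zero hl0 hp1) h1
  have hq : quadVal (blockForm (a 0) (b 0) (c 0)) u = 0 := by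
    rw [hu, H.equation.self_of_nhds, quadVal_smul_right]
    unfold RealConicBundle.eqn at hp3
    rw [hp0] at hp3
    rw [hp3]; simp
  refine ⟨(u 0).re, (u 1).re, (u 2).re, ?_, ?_⟩
  · by_contra! h
    apply hu0
    ext i
    fin_cases i
    · change u 0 = 0; rw [hur, h.1]; simp
    · change u 1 = 0; rw [hur, h.2.1]; simp
    · change u 2 = 0; rw [hur, h.2.2]; simp
  · rw [quadVal_blockForm, H.germ_a.value_eq_re, H.germ_b.value_eq_re, H.germ_c.value_eq_re,
      hur 0, hur 1, hur 2] at hq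
    exact_mod_cast hq

/-- The central fibre is a smooth conic with real points, or `m` is odd and it is a double line. -/
theorem central_fibre (H : α.IsBlockForm g B a b c e) (h_zero : ∀ k, α.σ k 0 = 0) (hm : 2 ≤ m)
    (h_real : ∃ p ∈ X.total, p.2 = 0 ∧ IsRealPt p)
    (h_fix : ∀ k : ZMod m, k ≠ 0 → ∀ p ∈ α.fixedPts k, ¬ IsRealPt p) :
    ((a 0).re < 0 ∧ 0 < (a 0).re * (c 0).re - (b 0).re ^ 2) ∨
      (Odd m ∧ a 0 = 0 ∧ b 0 = 0 ∧ c 0 = 0) := by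
  -- A positive definite binary form would make the whole equation positive definite, leaving no
  -- real point on the central fibre.
  have hneg : 0 < (a 0).re * (c 0).re - (b 0).re ^ 2 → (a 0).re < 0 := fun hd => by
    obtain ⟨x, y, z, h0, h⟩ := H.exists_real_zero h_real
    by_contra! ha
    have ha' : 0 < (a 0).re := lt_of_le_of_ne ha fun h => by
      rw [← h] at hd; nlinarith [sq_nonneg (b 0).re]
    have h1 : (a 0).re * z ^ 2 + ((a 0).re * x + (b 0).re * y) ^ 2 +
        ((a 0).re * (c 0).re - (b 0).re ^ 2) * y ^ 2 = 0 := by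
      linear_combination (a 0).re * h
    have h2 : 0 ≤ (a 0).re * z ^ 2 := by positivity
    have h3 : 0 ≤ ((a 0).re * (c 0).re - (b 0).re ^ 2) * y ^ 2 := by positivity
    have h4 := sq_nonneg ((a 0).re * x + (b 0).re * y)
    have hz : z = 0 := by
      have : (a 0).re * z ^ 2 = 0 := by linarith
      simpa [ha'.ne'] using this
    have hy : y = 0 := by
      have : ((a 0).re * (c 0).re - (b 0).re ^ 2) * y ^ 2 = 0 := by linarith
      simpa [hd.ne'] using this
    have hx : x = 0 := by
      have : ((a 0).re * x + (b 0).re * y) ^ 2 = 0 := by linarith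
      simpa [hy, ha'.ne'] using this
    simp [hx, hy, hz] at h0
  rcases Nat.even_or_odd m with he | ho
  · have hd := H.disc_pos_of_even h_zero hm h_fix he
    exact Or.inl ⟨hneg hd, hd⟩
  · have hm3 : 3 ≤ m := by
      rcases ho with ⟨r, hr⟩; omega
    obtain ⟨hb, hac⟩ := H.scalar_at_zero h_zero hm3
    by_cases ha : a 0 = 0
    · exact Or.inr ⟨ho, ha, hb, by rw [← hac, ha]⟩
    · have hd : 0 < (a 0).re * (c 0).re - (b 0).re ^ 2 := by
        have : (a 0).re ≠ 0 := fun h => ha (by rw [H.germ_a.value_eq_re, h]; simp)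
        rw [hb, ← hac]
        simp only [Complex.zero_re]
        have := mul_self_pos.2 this
        linarith
      exact Or.inl ⟨hneg hd, hd⟩

end ConicBundleAction.IsBlockForm

/-! ### Linearization of the action on the base. -/

/-- Conjugation is only ℝ-linear, so both sides of the reality relation are differentiated over ℝ
and compared by uniqueness of the derivative. -/
theorem RealGerm.fderiv_star {f : BaseC → ℂ} (hf : RealGerm f) (v : BaseC) :
    fderiv ℂ f 0 (star v) = star (fderiv ℂ f 0 v) := by
  have h1 : HasFDerivAt f ((fderiv ℂ f 0).restrictScalars ℝ) 0 :=
    hf.1.differentiableAt.hasFDerivAt.restrictScalars ℝ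
  have h2 : HasFDerivAt (fun s : BaseC => star s)
      (starL' ℝ : BaseC ≃L[ℝ] BaseC).toContinuousLinearMap 0 :=
    (starL' ℝ : BaseC ≃L[ℝ] BaseC).hasFDerivAt
  have h3 : HasFDerivAt (fun s => f (star s)) _ 0 := HasFDerivAt.comp (0 : BaseC) (g := f)
    (f := fun s : BaseC => star s) (by rw [star_zero]; exact h1) h2
  have h4 : HasFDerivAt (fun s => star (f s)) _ 0 :=
    (starL' ℝ : ℂ ≃L[ℝ] ℂ).hasFDerivAt.comp (0 : BaseC) h1
  have h5 := (h4.congr_of_eventuallyEq hf.2).unique h3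
  have h6 := congrArg (fun L => L v) h5
  simpa using h6.symm

/-- `φ` is a real holomorphic coordinate system at the origin. -/
structure IsCoord (φ : BaseC → BaseC) : Prop where
  germ : VecGerm φ
  map_zero : φ 0 = 0
  deriv : ∃ L : BaseC ≃L[ℂ] BaseC, HasFDerivAt φ (L : BaseC →L[ℂ] BaseC) 0

namespace IsCoord

variable {φ : BaseC → BaseC}

theorem exists_homeomorph (hφ : IsCoord φ) : ∃ ψ : OpenPartialHomeomorph BaseC BaseC,
    (∀ s, ψ s = φ s) ∧ (0 : BaseC) ∈ ψ.source ∧ AnalyticAt ℂ ψ.symm 0 := by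
  obtain ⟨L, hL⟩ := hφ.deriv
  have hs : HasStrictFDerivAt φ (L : BaseC →L[ℂ] BaseC) 0 := by
    rw [← hL.fderiv]; exact hφ.germ.analyticAt.hasStrictFDerivAt
  have hmem := hs.mem_toOpenPartialHomeomorph_source
  refine ⟨hs.toOpenPartialHomeomorph φ, fun s => rfl, hmem, ?_⟩
  have := (hs.toOpenPartialHomeomorph φ).analyticAt_symm' (i := L) hmem hφ.germ.analyticAt hL.fderiv
  have h0 : (hs.toOpenPartialHomeomorph φ) 0 = 0 := hφ.map_zero
  rwa [h0] at this

theorem mulVec (hφ : IsCoord φ) {K : Matrix (Fin 2) (Fin 2) ℝ} (hK : K.det ≠ 0) :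
    IsCoord fun s => (K.map Complex.ofReal).mulVec (φ s) := by
  refine ⟨(MatGerm.ofReal K).mulVec hφ.germ, by rw [hφ.map_zero, Matrix.mulVec_zero], ?_⟩
  obtain ⟨L, hL⟩ := hφ.deriv
  have hdet : (K.map Complex.ofReal).det ≠ 0 := by rw [det_map_ofReal]; exact_mod_cast hK
  let M : BaseC ≃ₗ[ℂ] BaseC := Matrix.toLinearEquiv' (K.map Complex.ofReal)
    (Matrix.invertibleOfIsUnitDet _ hdet.isUnit)
  refine ⟨L.trans M.toContinuousLinearEquiv, ?_⟩
  exact (M.toContinuousLinearEquiv.hasFDerivAt (x := φ 0)).comp (0 : BaseC) hL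

end IsCoord

/-- The angle lies strictly between 0 and 2π, so it can only be π. -/
theorem sin_eq_zero_imp_even {m j : ℕ} (h0 : 0 < j) (hj : j < m)
    (h : Real.sin (2 * Real.pi * j / m) = 0) : Even m := by
  obtain ⟨n, hn⟩ := Real.sin_eq_zero_iff.1 h
  have hm : (m : ℝ) ≠ 0 := by exact_mod_cast (by omega : m ≠ 0)
  have h1 : (n : ℝ) * m = 2 * j := by
    have hpi := Real.pi_ne_zero
    field_simp at hn
    linarith
  have h2 : n * (m : ℤ) = 2 * j := by exact_mod_cast h1
  have hn1 : n = 1 := by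
    have hlt : n < 2 := by
      by_contra! hc
      have : (2 : ℤ) * m ≤ n * m := by gcongr
      omega
    have hgt : 0 < n := by
      by_contra! hc
      have : n * (m : ℤ) ≤ 0 := mul_nonpos_of_nonpos_of_nonneg hc (by positivity)
      omega
    omega
  rw [hn1] at h2
  exact ⟨j, by omega⟩

namespace ConicBundleAction

variable {X : RealConicBundle} {m : ℕ} (α : ConicBundleAction X m)

/-- Averaging again: N(k) is the differential of `α.σ k` at the origin, real because the action is,
and φ is the sum of the maps N(-k) ∘ `α.σ k`. Its differential is m times the identity, so it is a
coordinate system. -/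
theorem exists_base_linearization (hm : 2 ≤ m) (h_zero : ∀ k, α.σ k 0 = 0) :
    ∃ (N : ZMod m → Matrix (Fin 2) (Fin 2) ℝ) (φ : BaseC → BaseC), N 0 = 1 ∧
      (∀ k l, N (k + l) = N k * N l) ∧ IsCoord φ ∧
      ∀ k, ∀ᶠ s in 𝓝 (0 : BaseC), φ (α.σ k s) = ((N k).map Complex.ofReal).mulVec (φ s) := by
  have : NeZero m := ⟨by omega⟩
  have hd : ∀ k, HasFDerivAt (α.σ k) (fderiv ℂ (α.σ k) 0) 0 := fun k =>
    (α.vecGerm_base k).analyticAt.differentiableAt.hasFDerivAt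
  set D : ZMod m → Matrix (Fin 2) (Fin 2) ℂ :=
    fun k => LinearMap.toMatrix' (fderiv ℂ (α.σ k) 0 : BaseC →ₗ[ℂ] BaseC) with hD
  have hDv : ∀ k v, (D k).mulVec v = fderiv ℂ (α.σ k) 0 v := fun k v => by
    rw [hD]; exact LinearMap.toMatrix'_mulVec _ _
  have hreal : ∀ k, ∃ N : Matrix (Fin 2) (Fin 2) ℝ, D k = N.map Complex.ofReal := fun k => by
    refine ⟨Matrix.of fun i j => (D k i j).re, ?_⟩
    ext i j
    have h1 : D k i j = fderiv ℂ (fun s => α.σ k s i) 0 (Pi.single j 1) := by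
      have h2 : HasFDerivAt (fun s => α.σ k s i) _ 0 := (hasFDerivAt_pi'.1 (hd k)) i
      rw [h2.fderiv]
      change _ = fderiv ℂ (α.σ k) 0 (Pi.single j 1) i
      rw [← hDv]
      simp
    have h3 := (α.vecGerm_base k i).fderiv_star (Pi.single j 1)
    have h4 : star (Pi.single j 1 : BaseC) = Pi.single j 1 := by
      ext i
      by_cases h : i = j
      · subst h; simp
      · simp [h]
    rw [h4, ← h1] at h3
    simpa using (Complex.conj_eq_iff_re.1 h3.symm).symm
  choose N hN using hreal
  have hNadd : ∀ k l, N (k + l) = N k * N l := fun k l => by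
    apply map_ofReal_injective
    simp only [map_ofReal_mul, ← hN, hD, ← LinearMap.toMatrix'_comp]
    congr 1
    have h1 : HasFDerivAt (fun s => α.σ k (α.σ l s)) _ 0 :=
      HasFDerivAt.comp (0 : BaseC) (g := α.σ k) (f := α.σ l) (by rw [h_zero]; exact hd k) (hd l)
    have h2 : α.σ (k + l) =ᶠ[𝓝 0] fun s => α.σ k (α.σ l s) := by
      filter_upwards [eventually_mem_base X] with s hs using α.σ_add k l s hs
    rw [h2.fderiv_eq, h1.fderiv]
    rfl
  have hN0 : N 0 = 1 := by
    apply map_ofReal_injective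
    simp only [map_ofReal_one, ← hN, hD]
    have h2 : α.σ 0 =ᶠ[𝓝 0] fun s => s := by
      filter_upwards [eventually_mem_base X] with s hs using α.σ_zero s hs
    rw [h2.fderiv_eq, fderiv_fun_id]
    exact LinearMap.toMatrix'_id
  set φ : BaseC → BaseC := fun s => ∑ k : ZMod m, ((N (-k)).map Complex.ofReal).mulVec (α.σ k s)
    with hφ
  refine ⟨N, φ, hN0, hNadd, ⟨fun i => ?_, ?_, ?_⟩, fun l => ?_⟩
  · simp only [hφ, Finset.sum_apply]
    exact RealGerm.sum _ fun k _ => (MatGerm.ofReal (N (-k))).mulVec (α.vecGerm_base k) i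
  · simp [hφ, h_zero]
  · have hm0 : (m : ℂ) ≠ 0 := by exact_mod_cast NeZero.ne m
    refine ⟨ContinuousLinearEquiv.smulLeft (Units.mk0 (m : ℂ) hm0), ?_⟩
    have h1 : ∀ k ∈ (Finset.univ : Finset (ZMod m)),
        HasFDerivAt (fun s => ((N (-k)).map Complex.ofReal).mulVec (α.σ k s))
          (ContinuousLinearMap.id ℂ BaseC) 0 := fun k _ => by
      have h2 := ((Matrix.mulVecLin ((N (-k)).map Complex.ofReal)).toContinuousLinearMap.hasFDerivAt
        (x := α.σ k 0)).comp (0 : BaseC) (hd k)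
      refine h2.congr_fderiv ?_
      ext1 v
      simp only [ContinuousLinearMap.comp_apply, ← hDv]
      change ((N (-k)).map Complex.ofReal).mulVec ((D k).mulVec v) = v
      rw [hN, Matrix.mulVec_mulVec, ← map_ofReal_mul, ← hNadd, neg_add_cancel, hN0, map_ofReal_one,
        Matrix.one_mulVec]
    refine (HasFDerivAt.fun_sum h1).congr_fderiv ?_
    ext1 v
    simp [Finset.card_univ, ZMod.card]
    ext i
    simp
  · filter_upwards [eventually_mem_base X] with s hs
    simp only [hφ, Matrix.mulVec_sum]
    rw [← Equiv.sum_comp (Equiv.addRight l) fun k =>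
      ((N l).map Complex.ofReal).mulVec (((N (-k)).map Complex.ofReal).mulVec (α.σ k s))]
    refine Finset.sum_congr rfl fun k _ => ?_
    rw [Matrix.mulVec_mulVec, ← map_ofReal_mul, ← hNadd, ← α.σ_add k l s hs]
    simp

namespace IsBlockForm

variable {α} {g : (ZMod m)ˣ} {B : BaseC → Matrix (Fin 3) (Fin 3) ℂ} {a b c e : BaseC → ℂ}

/-- Over the fixed points of a nontrivial element on the base there is a continuous family of fixed
points on the fibres. -/
theorem exists_fixed_section (H : α.IsBlockForm g B a b c e)
    (hcent : Even m → 0 < (a 0).re * (c 0).re - (b 0).re ^ 2) {j : ℕ} (h0 : 0 < j) (hj : j < m) :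
    ∃ (v : BaseC → FibC) (l : ℂ), ContinuousAt v 0 ∧ ∀ᶠ s in 𝓝 (0 : BaseC),
      α.σ (j * g) s = s → v s ≠ 0 ∧ (fibRot m j).mulVec (v s) = l • v s ∧
        quadVal (blockForm (a s) (b s) (c s)) (v s) = 0 := by
  set p : ℂ := (Real.cos (2 * Real.pi * j / m) : ℂ)
  set q : ℂ := (Real.sin (2 * Real.pi * j / m) : ℂ) with hq
  have hpq : p ^ 2 + q ^ 2 = 1 := by
    simp only [p, q]; exact_mod_cast Real.cos_sq_add_sin_sq _
  have hR : fibRot m j = !![p, q, 0; -q, p, 0; 0, 0, 1] := rfl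
  -- If q = 0 the element is the half turn, which fixes every point of z = 0; a zero of the form
  -- there is given by the quadratic formula. The discriminant is positive at the origin, so the
  -- principal square root is continuous nearby.
  by_cases hq0 : q = 0
  · have hev : Even m := sin_eq_zero_imp_even h0 hj (by rw [hq] at hq0; exact_mod_cast hq0)
    have hd := hcent hev
    set δ : BaseC → ℂ := fun s => a s * c s - b s * b s with hδ
    have hδg : RealGerm δ := (H.germ_a.mul H.germ_c).sub (H.germ_b.mul H.germ_b)
    have hδ0 : δ 0 ∈ Complex.slitPlane := by
      refine Or.inl ?_
      simp only [hδ]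
      rw [H.germ_a.value_eq_re, H.germ_b.value_eq_re, H.germ_c.value_eq_re]
      norm_cast
      linarith
    have ha0 : a 0 ≠ 0 := fun h => by
      rw [h] at hd
      simp at hd
      nlinarith [sq_nonneg (b 0).re]
    have hroot : ContinuousAt (fun s => δ s ^ (((2 : ℕ) : ℂ)⁻¹)) 0 :=
      (hδg.1.cpow analyticAt_const hδ0).continuousAt
    refine ⟨fun s => ![-b s + Complex.I * δ s ^ (((2 : ℕ) : ℂ)⁻¹), a s, 0], p, ?_, ?_⟩
    · refine continuousAt_pi.2 fun i => ?_
      fin_cases i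
      · exact H.germ_b.continuousAt.neg.add (continuousAt_const.mul hroot)
      · exact H.germ_a.continuousAt
      · exact continuousAt_const
    · filter_upwards [H.germ_a.eventually_ne ha0] with s hs _
      refine ⟨fun h => hs (congrFun h 1), ?_, ?_⟩
      · rw [hR, hq0]
        ext i; fin_cases i <;> simp [Matrix.mulVec, dotProduct, Fin.sum_univ_three]
      · rw [quadVal_blockForm]
        have h2 : (δ s ^ (((2 : ℕ) : ℂ)⁻¹)) ^ 2 = δ s := Complex.cpow_nat_inv_pow _ (by norm_num)
        generalize δ s ^ (((2 : ℕ) : ℂ)⁻¹) = r at h2 ⊢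
        simp only [hδ] at h2
        simp
        linear_combination (-a s) * h2 + a s * r ^ 2 * Complex.I_sq
  -- Over a fixed point of the base the form is a multiple of x² + y², which vanishes at the
  -- eigenvector (1, i, 0).
  · refine ⟨fun _ => ![1, Complex.I, 0], p + Complex.I * q, continuousAt_const, ?_⟩
    filter_upwards [H.invariant_entries j] with s hs hσ
    obtain ⟨h00, h01, -⟩ := hs p q hR
    rw [hσ] at h00 h01
    obtain ⟨hb, hac⟩ := eq_of_rotation_invariant hpq hq0 h00 h01
    refine ⟨fun h => one_ne_zero (congrFun h 0), ?_, ?_⟩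
    · rw [hR]
      ext i; fin_cases i <;> simp [Matrix.mulVec, dotProduct, Fin.sum_univ_three]
      · ring
      · linear_combination (-q) * Complex.I_sq
    · rw [quadVal_blockForm, hb, hac]
      simp

/-- If the fixed points on `Y` are isolated then no nontrivial element has the eigenvalue one on the
tangent space of the base. -/
theorem det_sub_one_ne_zero (H : α.IsBlockForm g B a b c e) (hm : 2 ≤ m)
    (h_zero : ∀ k, α.σ k 0 = 0) (hcent : Even m → 0 < (a 0).re * (c 0).re - (b 0).re ^ 2)
    (h_fix : ∀ k : ZMod m, k ≠ 0 → OnlyIsolatedPts (α.fixedPts k))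
    {φ : BaseC → BaseC} (hφ : IsCoord φ) {k : ZMod m} (hk : k ≠ 0)
    {N : Matrix (Fin 2) (Fin 2) ℝ}
    (hN : ∀ᶠ s in 𝓝 (0 : BaseC), φ (α.σ k s) = (N.map Complex.ofReal).mulVec (φ s)) :
    (N - 1).det ≠ 0 := by
  have : NeZero m := ⟨by omega⟩
  intro hdet
  obtain ⟨w, hw0, hw⟩ : ∃ w : BaseC, w ≠ 0 ∧ (N.map Complex.ofReal).mulVec w = w := by
    have h1 : (N.map Complex.ofReal - 1).det = 0 := by
      have h2 : N.map Complex.ofReal - 1 = (N - 1).map Complex.ofReal := by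
        rw [← map_ofReal_one, Matrix.map_sub _ Complex.ofReal_sub]
      rw [h2, det_map_ofReal, hdet, Complex.ofReal_zero]
    obtain ⟨w, hw0, hw⟩ := Matrix.exists_mulVec_eq_zero_iff.2 h1
    exact ⟨w, hw0, by rwa [Matrix.sub_mulVec, Matrix.one_mulVec, sub_eq_zero] at hw⟩
  obtain ⟨j, hj0, hjm, rfl⟩ : ∃ j : ℕ, 0 < j ∧ j < m ∧ (j : ZMod m) * g = k := by
    refine ⟨(k * (g⁻¹ : (ZMod m)ˣ)).val, ?_, ZMod.val_lt _, ?_⟩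
    · rw [ZMod.val_pos]
      simpa using hk
    · rw [ZMod.natCast_zmod_val, mul_assoc, Units.inv_mul, mul_one]
  obtain ⟨v, l, hvc, hv⟩ := H.exists_fixed_section hcent hj0 hjm
  obtain ⟨ψ, hψ, hψ0, hψa⟩ := hφ.exists_homeomorph
  have hψ0' : ψ.symm 0 = 0 := by
    have := ψ.left_inv hψ0
    rwa [hψ, hφ.map_zero] at this
  have htarget : ψ.target ∈ 𝓝 (0 : BaseC) := by
    refine ψ.open_target.mem_nhds ?_
    have := ψ.map_source hψ0
    rwa [hψ, hφ.map_zero] at this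
  have hlin : Tendsto (fun t : ℂ => t • w) (𝓝[≠] 0) (𝓝 0) := by
    have : ContinuousAt (fun t : ℂ => t • w) 0 := by fun_prop
    have h1 := this.tendsto.mono_left (nhdsWithin_le_nhds (s := {0}ᶜ))
    simpa using h1
  -- In the linearizing coordinates the line spanned by the eigenvector w consists of fixed points;
  -- the section over it gives fixed points on Y accumulating at the one over the origin.
  have hγ : Tendsto (fun t : ℂ => ψ.symm (t • w)) (𝓝[≠] 0) (𝓝 0) := by
    have h1 := hψa.continuousAt.tendsto
    rw [hψ0'] at h1
    exact h1.comp hlin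
  have hφγ : ∀ᶠ t : ℂ in 𝓝[≠] 0, φ (ψ.symm (t • w)) = t • w := by
    filter_upwards [hlin.eventually htarget] with t ht
    rw [← hψ]; exact ψ.right_inv ht
  have hfixγ : ∀ᶠ t : ℂ in 𝓝[≠] 0, α.σ (j * g) (ψ.symm (t • w)) = ψ.symm (t • w) := by
    have hσ := (α.vecGerm_base (j * g)).tendsto (h_zero _)
    have hsrc : ∀ᶠ s in 𝓝 (0 : BaseC), s ∈ ψ.source := ψ.open_source.mem_nhds hψ0
    filter_upwards [hφγ, hγ.eventually hN, hγ.eventually (hσ.eventually hsrc),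
      hγ.eventually hsrc] with t h1 h2 h3 h4
    refine ψ.injOn h3 h4 ?_
    rw [hψ, hψ, h2, h1, Matrix.mulVec_smul, hw]
  have hne : ∀ᶠ t : ℂ in 𝓝[≠] 0, ψ.symm (t • w) ≠ 0 := by
    filter_upwards [hφγ, self_mem_nhdsWithin] with t h1 h2 h3
    rw [h3, hφ.map_zero] at h1
    exact smul_ne_zero h2 hw0 h1.symm
  set P : BaseC → FibC × BaseC := fun s => ((B s)⁻¹.mulVec (v s), s) with hP
  have hPc : ContinuousAt P 0 := by
    refine ContinuousAt.prodMk ?_ continuousAt_id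
    refine continuousAt_pi.2 fun i => ?_
    simp only [Matrix.mulVec, dotProduct]
    exact tendsto_finsetSum _ fun k _ =>
      ((H.matGerm.inv H.det_ne) i k).continuousAt.mul (continuousAt_pi.1 hvc k)
  have hPfix : ∀ᶠ s in 𝓝 (0 : BaseC), α.σ (j * g) s = s → P s ∈ α.fixedPts (j * g) := by
    filter_upwards [hv, H.eventually_fixed j] with s h1 h2 hs
    obtain ⟨h3, h4, h5⟩ := h1 hs
    exact h2 hs _ l h3 h4 h5
  obtain ⟨U, hU, hUiso⟩ := h_fix _ hk (P 0) (hPfix.self_of_nhds (h_zero _))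
  have hPU : ∀ᶠ t : ℂ in 𝓝[≠] 0, P (ψ.symm (t • w)) ∈ U :=
    hγ.eventually (hPc.tendsto.eventually hU)
  obtain ⟨t, h1, h2, h3, h4⟩ :=
    (hPU.and (hfixγ.and (hne.and (hγ.eventually hPfix)))).exists
  exact h3 (hUiso _ ⟨h1, h4 h2⟩).1

/-- Absence of the eigenvalue 1 is used twice: for the generator it excludes a reflection, and for
its powers it shows that the order is exactly m, so that n is prime to m. -/
theorem exists_base_rotation (H : α.IsBlockForm g B a b c e) (hm : 2 ≤ m)
    (h_zero : ∀ k, α.σ k 0 = 0) (hcent : Even m → 0 < (a 0).re * (c 0).re - (b 0).re ^ 2)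
    (h_fix : ∀ k : ZMod m, k ≠ 0 → OnlyIsolatedPts (α.fixedPts k)) :
    ∃ (n : ℕ) (φ : BaseC → BaseC), n.Coprime m ∧ IsCoord φ ∧
      ∀ᶠ s in 𝓝 (0 : BaseC), φ (α.σ g s) = (baseRot m n 1).mulVec (φ s) := by
  obtain ⟨N, φ, hN0, hNadd, hφ, hφN⟩ := α.exists_base_linearization hm h_zero
  have hne : ∀ k, k ≠ 0 → (N k - 1).det ≠ 0 := fun k hk =>
    H.det_sub_one_ne_zero hm h_zero hcent h_fix hφ hk (hφN k)
  have hpow : ∀ j : ℕ, N g ^ j = 1 ↔ m ∣ j := fun j => by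
    rw [← pow_apply_one_of_add hN0 hNadd]
    constructor
    · intro h
      by_contra hc
      refine hne (j * g) ?_ (by rw [h, sub_self]; simp)
      rwa [Ne, Units.mul_left_eq_zero, ZMod.natCast_eq_zero_iff]
    · intro h
      rw [(ZMod.natCast_eq_zero_iff j m).2 h, zero_mul, hN0]
  have : Fact (1 < m) := ⟨by omega⟩
  obtain ⟨P, z, hP, hz⟩ := exists_conj_rotTwo (N g) (by omega) ((hpow m).2 dvd_rfl)
    (hne g g.ne_zero)
  have hzp : IsPrimitiveRoot z m :=
    isPrimitiveRoot_of_conj rotTwo_injective rotTwo_one rotTwo_pow hP hz hpow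
  obtain ⟨n, hn, hzn⟩ := exists_pow_exp_of_isPrimitiveRoot (by omega) hzp
  refine ⟨n, _, hn, hφ.mulVec hP, ?_⟩
  filter_upwards [hφN g] with s hs
  rw [hs, baseRot_eq, pow_one, ← hzn, ← hz, Matrix.mulVec_mulVec, Matrix.mulVec_mulVec,
    ← map_ofReal_mul, ← map_ofReal_mul, Matrix.mul_assoc, Matrix.mul_assoc,
    Matrix.nonsing_inv_mul _ hP.isUnit, Matrix.mul_one]

end IsBlockForm

end ConicBundleAction

/-! ### From germs to an equivalence on an invariant neighbourhood. -/

theorem RealGerm.isBigO_norm {f : BaseC → ℂ} (hf : RealGerm f) (h0 : f 0 = 0) :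
    f =O[𝓝 0] fun s => ‖s‖ ^ 1 := by
  have := hf.1.differentiableAt.isBigO_sub
  simp only [h0, sub_zero] at this
  simpa using this.norm_right

theorem RealGerm.isBigO_norm_sq {f : BaseC → ℂ} (hf : RealGerm f) (h0 : f 0 = 0)
    (h1 : fderiv ℂ f 0 = 0) : f =O[𝓝 0] fun s => ‖s‖ ^ 2 := by
  obtain ⟨p, hp⟩ := hf.1
  have h2 := hp.isBigO_sub_partialSum_pow 2
  have h3 : ∀ y, p.partialSum 2 y = 0 := fun y => by
    have h4 : p 1 (fun _ => y) = 0 := by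
      have h5 := hp.fderiv_eq
      rw [h1] at h5
      have h6 := congrArg (fun L => L y) h5
      have h7 : (fun _ : Fin 1 => y) = ![y] := by ext i; fin_cases i; rfl
      rw [h7]
      simpa using h6.symm
    simp [FormalMultilinearSeries.partialSum, Finset.sum_range_succ, h4, hp.coeff_zero, h0]
  simpa [h3] using h2

theorem fibRot_succ (m j : ℕ) : fibRot m (j + 1) = fibRot m 1 * fibRot m j := by
  rw [fibRot_eq, fibRot_eq, fibRot_eq, ← map_ofReal_mul, ← rotThree_mul, pow_one, pow_succ']

theorem fibRot_zero (m : ℕ) : fibRot m 0 = 1 := by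
  rw [fibRot_eq, pow_zero, rotThree_one, map_ofReal_one]

theorem baseRot_succ (m b j : ℕ) : baseRot m b (j + 1) = baseRot m b 1 * baseRot m b j := by
  rw [baseRot_eq, baseRot_eq, baseRot_eq, ← map_ofReal_mul, ← rotTwo_mul, pow_one, pow_succ']

theorem baseRot_zero (m b : ℕ) : baseRot m b 0 = 1 := by
  rw [baseRot_eq, pow_zero, rotTwo_one, map_ofReal_one]

namespace ConicBundleAction

variable {X : RealConicBundle} {m : ℕ} (α : ConicBundleAction X m)

/-- Every neighbourhood of the origin contains one that is invariant under the action and under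
complex conjugation. -/
theorem exists_invariant_open (hm : 2 ≤ m) (h_zero : ∀ k, α.σ k 0 = 0) {p : BaseC → Prop}
    (hp : ∀ᶠ s in 𝓝 (0 : BaseC), p s) :
    ∃ U : Set BaseC, IsOpen U ∧ (0 : BaseC) ∈ U ∧ (∀ s ∈ U, p s) ∧ (∀ s ∈ U, star s ∈ U) ∧
      ∀ k, Set.MapsTo (α.σ k) U U := by
  have : NeZero m := ⟨by omega⟩
  obtain ⟨W, hW, hWo, hW0⟩ := eventually_nhds_iff.1 hp
  -- The intersection of all translates of a conjugation-symmetric neighbourhood is invariant, and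
  -- it is open because the group is finite.
  refine ⟨⋂ k : ZMod m, X.S ∩ (α.σ k) ⁻¹' (W ∩ star ⁻¹' W), ?_, ?_, ?_, ?_, ?_⟩
  · refine isOpen_iInter_of_finite fun k => ?_
    exact (α.σ_analytic k).continuousOn.isOpen_inter_preimage X.isOpen_S
      (hWo.inter (hWo.preimage continuous_star))
  · simp only [Set.mem_iInter]
    intro k
    refine ⟨X.zero_mem, ?_⟩
    simp [h_zero, hW0]
  · intro s hs
    have h1 := Set.mem_iInter.1 hs 0
    have h2 := h1.2.1
    rw [α.σ_zero s h1.1] at h2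
    exact hW s h2
  · intro s hs
    refine Set.mem_iInter.2 fun k => ?_
    have h1 := Set.mem_iInter.1 hs k
    refine ⟨X.star_mem s h1.1, ?_⟩
    rw [Set.mem_preimage, α.σ_real k s h1.1]
    exact ⟨h1.2.2, by simpa using h1.2.1⟩
  · intro l s hs
    refine Set.mem_iInter.2 fun k => ?_
    have h1 := Set.mem_iInter.1 hs (k + l)
    refine ⟨α.σ_mapsTo l h1.1, ?_⟩
    rw [Set.mem_preimage, ← α.σ_add k l s h1.1]
    exact h1.2

/-- All germ conditions are imposed together on one invariant neighbourhood, and h is the difference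
between the equation in the new coordinates and the model. Only the generator needs checking; its
powers follow by induction, up to scalars. -/
theorem equivariantlyEquivalent_of_germs (hm : 2 ≤ m) (h_zero : ∀ k, α.σ k 0 = 0) {g : ZMod m}
    {φ : BaseC → BaseC} (hφ : IsCoord φ) {n : ℕ}
    (hφg : ∀ᶠ s in 𝓝 (0 : BaseC), φ (α.σ g s) = (baseRot m n 1).mulVec (φ s))
    {B F M : BaseC → Matrix (Fin 3) (Fin 3) ℂ} (hB : MatGerm B) (hB0 : (B 0).det ≠ 0)
    (hBA : ∀ᶠ s in 𝓝 (0 : BaseC), ∃ c : ℂ, c ≠ 0 ∧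
      B (α.σ g s) * α.A g s = c • (fibRot m 1 * B s))
    (hF : MatGerm F) (hFsymm : ∀ᶠ s in 𝓝 (0 : BaseC), (F s).IsSymm)
    (hFeq : ∀ᶠ s in 𝓝 (0 : BaseC), ∃ c : ℂ, c ≠ 0 ∧ ∀ v,
      quadVal (F s) ((B s).mulVec v) = c * quadVal (X.Q s) v)
    (hM : MatGerm M) (hMsymm : ∀ w, (M w).IsSymm) {N : BaseC → FibC → ℂ}
    (hN : ∀ w v, N w v = quadVal (M w) v) {i : ℕ}
    (hO : ∀ j k, (fun s => F s j k - M (φ s) j k) =O[𝓝 0] fun s => ‖s‖ ^ i) :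
    EquivariantlyEquivalent α g n N i := by
  obtain ⟨ψ, hψ, hψ0, hψa⟩ := hφ.exists_homeomorph
  have hψφ : (ψ : BaseC → BaseC) = φ := funext hψ
  have ht := hφ.germ.tendsto hφ.map_zero
  have hsymm0 : ψ.symm 0 = 0 := by
    have := ψ.left_inv hψ0
    rwa [hψ, hφ.map_zero] at this
  have hsrc : ∀ᶠ s in 𝓝 (0 : BaseC), s ∈ ψ.source := ψ.open_source.mem_nhds hψ0
  obtain ⟨U, hUo, hU0, hU, hUstar, hUσ⟩ := α.exists_invariant_open hm h_zero
    ((eventually_mem_base X).and <| hsrc.and <|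
      hφ.germ.analyticAt.eventually_analyticAt.and <|
      (ht.eventually hψa.eventually_analyticAt).and <| hφ.germ.eventually_star.and <|
      (eventually_all.2 fun i => eventually_all.2 fun j => (hB i j).1.eventually_analyticAt).and <|
      hB.eventually_star.and <| (hB.eventually_det_ne hB0).and <|
      (eventually_all.2 fun i => eventually_all.2 fun j => (hF i j).1.eventually_analyticAt).and <|
      hF.eventually_star.and <| hFsymm.and <|
      (ht.eventually (eventually_all.2 fun i => eventually_all.2 fun j =>
        (hM i j).1.eventually_analyticAt)).and <| (ht.eventually hM.eventually_star).and <|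
      hFeq.and <| hBA.and hφg)
  choose uS usrc uφ uψ uφs uB uBs uBd uF uFs uFsymm uM uMs uFeq uBA uφg using hU
  have hsource : (ψ.restrOpen U hUo).source = U := by
    rw [ψ.restrOpen_source]
    exact Set.inter_eq_right.2 usrc
  have htarget : ∀ w ∈ (ψ.restrOpen U hUo).target, ∃ s ∈ U, φ s = w ∧ ψ.symm w = s := by
    intro w hw
    have h1 := (ψ.restrOpen U hUo).map_target hw
    rw [hsource] at h1
    refine ⟨_, h1, ?_, rfl⟩
    rw [← hψ]
    exact (ψ.restrOpen U hUo).right_inv hw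
  have hinv : ∀ s ∈ U, ψ.symm (φ s) = s := fun s hs => by
    rw [← hψ]; exact ψ.left_inv (usrc s hs)
  have hcoe : ∀ s, (ψ.restrOpen U hUo) s = φ s := hψ
  refine ⟨ψ.restrOpen U hUo, B, fun w => F (ψ.symm w) - M w, ?_, ?_, ?_, ?_, ?_⟩
  · rw [hsource]
    refine ⟨hU0, by rw [hcoe, hφ.map_zero], uS, hUstar, hUσ, fun s hs => ?_, fun w hw => ?_,
      fun s hs => ?_⟩
    · have : ((ψ.restrOpen U hUo : OpenPartialHomeomorph BaseC BaseC) : BaseC → BaseC) = φ := hψφ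
      rw [this]; exact uφ s hs
    · obtain ⟨s, hs, rfl, -⟩ := htarget w hw
      exact uψ s hs
    · rw [hcoe, hcoe, uφs s hs]
  · rw [hsource]
    exact ⟨fun i j s hs => uB s hs i j, uBs, uBd⟩
  · refine ⟨fun j k w hw => ?_, fun w hw => ?_, fun w hw => ?_, fun j k => ?_⟩
    · obtain ⟨s, hs, rfl, h2⟩ := htarget w hw
      refine AnalyticAt.sub ?_ (uM s hs j k)
      refine AnalyticAt.fun_comp (g := fun s => F s j k) (f := ψ.symm) ?_ (uψ s hs)
      rw [h2]; exact uF s hs j k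
    · obtain ⟨s, hs, rfl, h2⟩ := htarget w hw
      simp only
      rw [← uφs s hs, hinv _ (hUstar s hs), h2, uφs s hs, uMs s hs, uFs s hs]
      ext j k
      simp
    · obtain ⟨s, hs, rfl, h2⟩ := htarget w hw
      simp only [h2]
      exact (uFsymm s hs).sub (hMsymm _)
    · have hts : Tendsto ψ.symm (𝓝 0) (𝓝 0) := by
        have := hψa.continuousAt.tendsto
        rwa [hsymm0] at this
      have h1 := (hO j k).comp_tendsto hts
      have h2 : (fun w => ψ.symm w) =O[𝓝 0] fun w => w := by
        have := hψa.differentiableAt.isBigO_sub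
        simpa [hsymm0] using this
      have h3 : (fun w => ‖ψ.symm w‖ ^ i) =O[𝓝 0] fun w => ‖w‖ ^ i := (h2.norm_norm).pow i
      refine (IsBigO.congr' (h1.trans h3) ?_ EventuallyEq.rfl)
      have h4 : ∀ᶠ w in 𝓝 (0 : BaseC), w ∈ ψ.target := by
        refine ψ.open_target.mem_nhds ?_
        have := ψ.map_source hψ0
        rwa [hψ, hφ.map_zero] at this
      filter_upwards [h4] with w hw
      have h5 : φ (ψ.symm w) = w := by rw [← hψ]; exact ψ.right_inv hw
      simp [h5]
  · rw [hsource]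
    intro s hs
    obtain ⟨c, hc0, hc⟩ := uFeq s hs
    refine ⟨c, hc0, fun v => ?_⟩
    rw [hcoe, hN, ← hc]
    simp only [hinv s hs, quadVal, Matrix.sub_mulVec, dotProduct_sub]
    ring
  · rw [hsource]
    intro j s hs
    have hgen : ∀ j : ℕ, ((j + 1 : ℕ) : ZMod m) * g = g + j * g := fun j => by push_cast; ring
    induction j with
    | zero =>
      have hsS := uS s hs
      rw [Nat.cast_zero, zero_mul, baseRot_zero, fibRot_zero, Matrix.one_mulVec, α.σ_zero s hsS]
      obtain ⟨c, hc0, hc⟩ := α.A_zero s hsS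
      exact ⟨rfl, c, hc0, by rw [hc, Matrix.mul_smul, Matrix.mul_one, Matrix.one_mul]⟩
    | succ j ih =>
      have hsS := uS s hs
      have hs' := hUσ (j * g) hs
      rw [hgen, α.σ_add _ _ s hsS]
      refine ⟨?_, ?_⟩
      · rw [hcoe, uφg _ hs', ← hcoe, ih.1, Matrix.mulVec_mulVec, ← baseRot_succ]
      · obtain ⟨c₁, h₁, e₁⟩ := ih.2
        obtain ⟨c₂, h₂, e₂⟩ := uBA _ hs'
        obtain ⟨c₃, h₃, e₃⟩ := α.A_add g (j * g) s hsS
        refine ⟨c₃ * c₂ * c₁, mul_ne_zero (mul_ne_zero h₃ h₂) h₁, ?_⟩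
        rw [e₃, Matrix.mul_smul, ← Matrix.mul_assoc, e₂, Matrix.smul_mul, Matrix.mul_assoc, e₁,
          Matrix.mul_smul, ← Matrix.mul_assoc, ← fibRot_succ, smul_smul, smul_smul, mul_assoc]

end ConicBundleAction

/-! ### Smooth central fibre. -/

/-- A Cholesky decomposition of a negative definite binary form. -/
theorem exists_cholesky {a b c : ℝ} (ha : a < 0) (hd : 0 < a * c - b ^ 2) :
    ∃ k l n : ℝ, k ≠ 0 ∧ n ≠ 0 ∧ a = -k ^ 2 ∧ b = -(k * l) ∧ c = -l ^ 2 - n ^ 2 ∧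
      (b = 0 → a = c → l = 0 ∧ n = k) := by
  have hk : 0 < Real.sqrt (-a) := Real.sqrt_pos.2 (by linarith)
  have hk2 : Real.sqrt (-a) ^ 2 = -a := Real.sq_sqrt (by linarith)
  have hn : 0 < (a * c - b ^ 2) / -a := div_pos hd (by linarith)
  have hn2 := Real.sq_sqrt hn.le
  have hl2 : (-b / Real.sqrt (-a)) ^ 2 = -(b ^ 2 / a) := by
    rw [div_pow, hk2, neg_sq, div_neg]
  refine ⟨Real.sqrt (-a), -b / Real.sqrt (-a), Real.sqrt ((a * c - b ^ 2) / -a), hk.ne',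
    (Real.sqrt_pos.2 hn).ne', by rw [hk2]; ring, by field_simp, ?_, fun hb hac => ?_⟩
  · rw [hl2, hn2]
    have := ha.ne
    field_simp
    ring
  · refine ⟨by rw [hb]; simp, ?_⟩
    congr 1
    rw [hb, ← hac]
    have := ha.ne
    field_simp
    simp

namespace ConicBundleAction.IsBlockForm

variable {X : RealConicBundle} {m : ℕ} {α : ConicBundleAction X m} {g : (ZMod m)ˣ}
  {B : BaseC → Matrix (Fin 3) (Fin 3) ℂ} {a b c e : BaseC → ℂ}

theorem matGerm_blockForm (ha : RealGerm a) (hb : RealGerm b) (hc : RealGerm c) :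
    MatGerm fun s => blockForm (a s) (b s) (c s) := fun i j => by
  fin_cases i <;> fin_cases j
  · exact ha
  · exact hb
  · exact RealGerm.const (c := 0) (by simp)
  · exact hb
  · exact hc
  · exact RealGerm.const (c := 0) (by simp)
  · exact RealGerm.const (c := 0) (by simp)
  · exact RealGerm.const (c := 0) (by simp)
  · exact RealGerm.const (c := 1) (by simp)

/-- The case of a smooth central fibre. -/
theorem equivariantlyEquivalent_smooth (H : α.IsBlockForm g B a b c e) (hm : 2 ≤ m)
    (h_zero : ∀ k, α.σ k 0 = 0) (ha : (a 0).re < 0)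
    (hd : 0 < (a 0).re * (c 0).re - (b 0).re ^ 2) {φ : BaseC → BaseC} (hφ : IsCoord φ) {n : ℕ}
    (hφg : ∀ᶠ s in 𝓝 (0 : BaseC), φ (α.σ g s) = (baseRot m n 1).mulVec (φ s)) :
    EquivariantlyEquivalent α (g : ZMod m) n normalForm₁ 1 := by
  obtain ⟨k, l, r, hk, hr, h1, h2, h3, h4⟩ := exists_cholesky ha hd
  set L : Matrix (Fin 3) (Fin 3) ℂ :=
    (!![k, l, 0; 0, r, 0; 0, 0, 1] : Matrix (Fin 3) (Fin 3) ℝ).map Complex.ofReal with hL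
  have hL' : L = !![(k : ℂ), (l : ℂ), 0; 0, (r : ℂ), 0; 0, 0, 1] := by
    ext i j; fin_cases i <;> fin_cases j <;> simp [hL]
  have hLg : MatGerm fun _ => L := MatGerm.ofReal _
  have hLdet : L.det ≠ 0 := by
    rw [hL', Matrix.det_fin_three]
    simp [hk, hr]
  have hL0 : L.transpose * blockForm (-1) 0 (-1) * L = blockForm (a 0) (b 0) (c 0) := by
    rw [H.germ_a.value_eq_re, H.germ_b.value_eq_re, H.germ_c.value_eq_re, h1, h2, h3, hL']
    ext i j
    fin_cases i <;> fin_cases j <;>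
      simp [blockForm, Matrix.mul_apply, Fin.sum_univ_three] <;> ring
  -- For m = 2 the rotation is -1 on the (x, y)-plane. For m ≥ 3 the form is a multiple of x² + y²,
  -- so L is scalar there.
  have hLrot : L * fibRot m 1 = fibRot m 1 * L := by
    rcases hm.eq_or_lt with h | h
    · rw [← h, fibRot_half (r := 1) rfl one_ne_zero, hL']
      ext i j
      fin_cases i <;> fin_cases j <;> simp [Matrix.mul_apply, Fin.sum_univ_three]
    · obtain ⟨hb, hac⟩ := H.scalar_at_zero h_zero h
      obtain ⟨hl, hrk⟩ := h4 (by rw [hb]; simp) (by rw [hac])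
      obtain ⟨p, q, -, hpq⟩ := fibRot_shape m 1
      rw [hpq, hL', hl, hrk]
      ext i j
      fin_cases i <;> fin_cases j <;> simp [Matrix.mul_apply, Fin.sum_univ_three, mul_comm]
  set F : BaseC → Matrix (Fin 3) (Fin 3) ℂ :=
    fun s => L⁻¹.transpose * blockForm (a s) (b s) (c s) * L⁻¹ with hF
  have hFg : MatGerm F := ((hLg.inv hLdet).transpose.mul
    (matGerm_blockForm H.germ_a H.germ_b H.germ_c)).mul (hLg.inv hLdet)
  have hF0 : F 0 = blockForm (-1) 0 (-1) := by
    refine eq_of_conj_eq hLdet ?_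
    rw [hL0]
    simp only [hF, Matrix.mul_assoc, Matrix.nonsing_inv_mul _ hLdet.isUnit, Matrix.mul_one]
    rw [← Matrix.mul_assoc, ← Matrix.transpose_mul, Matrix.nonsing_inv_mul _ hLdet.isUnit,
      Matrix.transpose_one, Matrix.one_mul]
  have hconst : MatGerm fun _ => blockForm (-1) 0 (-1) :=
    matGerm_blockForm (RealGerm.const (by simp)) (RealGerm.const (by simp))
      (RealGerm.const (by simp))
  refine α.equivariantlyEquivalent_of_germs hm h_zero hφ hφg (hLg.mul H.matGerm)
    (by rw [Matrix.det_mul]; exact mul_ne_zero hLdet H.det_ne) ?_ hFg ?_ ?_ hconst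
    (fun _ => blockForm_isSymm _ _ _) (fun w v => ?_) (fun i j => ?_)
  · filter_upwards [H.linear 1] with s hs
    obtain ⟨d, hd0, hd⟩ := hs
    rw [Nat.cast_one, one_mul] at hd
    exact ⟨d, hd0, by rw [Matrix.mul_assoc, hd, Matrix.mul_smul, ← Matrix.mul_assoc, hLrot,
      Matrix.mul_assoc]⟩
  · refine Eventually.of_forall fun s => ?_
    unfold Matrix.IsSymm
    simp only [hF, Matrix.transpose_mul, Matrix.transpose_transpose, Matrix.mul_assoc,
      (blockForm_isSymm _ _ _).eq]
  · filter_upwards [H.equation, H.germ_e.eventually_ne H.e_ne] with s h5 h6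
    refine ⟨e s, h6, fun v => ?_⟩
    simp only [hF]
    rw [quadVal_transpose_mul_mul, Matrix.mulVec_mulVec,
      Matrix.nonsing_inv_mul_cancel_left _ _ hLdet.isUnit, h5]
  · rw [quadVal_blockForm, normalForm₁]
    ring
  · exact ((hFg i j).sub (hconst i j)).isBigO_norm (by simp only [hF0, sub_self])

/-! ### Double line as central fibre. -/

theorem hasFDerivAt_mul_zero {E : Type*} [NormedAddCommGroup E] [NormedSpace ℂ E] {f h : E → ℂ}
    {p : E} (hf : HasFDerivAt f (0 : E →L[ℂ] ℂ) p) (h0 : f p = 0) (hh : DifferentiableAt ℂ h p) :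
    HasFDerivAt (fun x => f x * h x) (0 : E →L[ℂ] ℂ) p := by
  refine (hf.mul hh.hasFDerivAt).congr_fderiv ?_
  ext1 v
  simp [h0]

/-- If the binary form vanishes to second order then all points of the line `z = 0` of the central
fibre are singular. -/
theorem mem_sing (H : α.IsBlockForm g B a b c e) (ha : a 0 = 0) (hb : b 0 = 0) (hc : c 0 = 0)
    (ha' : fderiv ℂ a 0 = 0) (hb' : fderiv ℂ b 0 = 0) (hc' : fderiv ℂ c 0 = 0) {v : FibC}
    (hv : v ≠ 0) (hv2 : v 2 = 0) : ((B 0)⁻¹.mulVec v, 0) ∈ X.sing := by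
  have hcancel : (B 0).mulVec ((B 0)⁻¹.mulVec v) = v := by
    rw [Matrix.mulVec_mulVec, Matrix.mul_nonsing_inv _ H.det_ne.isUnit, Matrix.one_mulVec]
  set p : FibC × BaseC := ((B 0)⁻¹.mulVec v, 0) with hp
  have hsnd : Tendsto (fun x : FibC × BaseC => x.2) (𝓝 p) (𝓝 0) := continuous_snd.tendsto p
  have hdsnd : ∀ {f : BaseC → ℂ}, RealGerm f →
      DifferentiableAt ℂ (fun x : FibC × BaseC => f x.2) p :=
    fun hf => DifferentiableAt.comp (g := fun s => _) p hf.1.differentiableAt differentiableAt_snd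
  have hzero : ∀ {f : BaseC → ℂ}, RealGerm f → fderiv ℂ f 0 = 0 →
      HasFDerivAt (fun x : FibC × BaseC => f x.2) (0 : FibC × BaseC →L[ℂ] ℂ) p := fun hf h => by
    have h1 := hf.1.differentiableAt.hasFDerivAt
    rw [h] at h1
    exact (HasFDerivAt.comp p (f := fun x : FibC × BaseC => x.2) h1 hasFDerivAt_snd).congr_fderiv
      (ContinuousLinearMap.zero_comp _)
  set u : Fin 3 → FibC × BaseC → ℂ := fun i x => (B x.2).mulVec x.1 i with hu
  have hud : ∀ i, DifferentiableAt ℂ (u i) p := fun i => by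
    simp only [hu, Matrix.mulVec, dotProduct]
    refine DifferentiableAt.fun_sum fun k _ => (hdsnd (H.matGerm i k)).mul ?_
    fun_prop
  have hup : ∀ i, u i p = v i := fun i => congrFun hcancel i
  set G : FibC × BaseC → ℂ := fun x =>
    quadVal (blockForm (a x.2) (b x.2) (c x.2)) ((B x.2).mulVec x.1) with hG
  have hG0 : G p = 0 := by
    simp only [hG, hp, hcancel, ha, hb, hc, quadVal_blockForm, hv2]
    simp
  -- The term z² is the square of a function vanishing at p; each other term has a coefficient
  -- vanishing together with its differential.
  have hGd : HasFDerivAt G (0 : FibC × BaseC →L[ℂ] ℂ) p := by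
    have e1 : HasFDerivAt (fun x => u 2 x * u 2 x) (0 : FibC × BaseC →L[ℂ] ℂ) p := by
      refine ((hud 2).hasFDerivAt.mul (hud 2).hasFDerivAt).congr_fderiv ?_
      refine ContinuousLinearMap.ext fun w => ?_
      simp [hup, hv2]
    have e2 := hasFDerivAt_mul_zero (hzero H.germ_a ha') ha ((hud 0).mul (hud 0))
    have e3 := hasFDerivAt_mul_zero (hzero H.germ_b hb') hb ((hud 0).mul (hud 1))
    have e4 := hasFDerivAt_mul_zero (hzero H.germ_c hc') hc ((hud 1).mul (hud 1))
    have e5 := ((e1.add e2).add (e3.add e3)).add e4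
    simp only [add_zero] at e5
    refine e5.congr_of_eventuallyEq (Eventually.of_forall fun x => ?_)
    simp only [hG, quadVal_blockForm, hu, Pi.add_apply, Pi.mul_apply]
    ring
  have heqn : X.eqn =ᶠ[𝓝 p] fun x => G x * (e x.2)⁻¹ := by
    filter_upwards [hsnd.eventually H.equation, hsnd.eventually (H.germ_e.eventually_ne H.e_ne)]
      with x h1 h2
    simp only [hG, h1, RealConicBundle.eqn]
    field_simp
  have hd : HasFDerivAt X.eqn (0 : FibC × BaseC →L[ℂ] ℂ) p :=
    (hasFDerivAt_mul_zero hGd hG0 (hdsnd (H.germ_e.inv H.e_ne))).congr_of_eventuallyEq heqn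
  refine ⟨⟨fun h => hv ?_, X.zero_mem, ?_⟩, hd.fderiv⟩
  · rw [← hcancel]
    simp only [hp] at h
    rw [h, Matrix.mulVec_zero]
  · rw [heqn.eq_of_nhds, hG0, zero_mul]

/-- The points (1:t:0) form a curve of singular points, distinct for distinct t. -/
theorem not_onlyIsolatedPts_sing (H : α.IsBlockForm g B a b c e) (ha : a 0 = 0) (hb : b 0 = 0)
    (hc : c 0 = 0) (ha' : fderiv ℂ a 0 = 0) (hb' : fderiv ℂ b 0 = 0) (hc' : fderiv ℂ c 0 = 0) :
    ¬ OnlyIsolatedPts X.sing := by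
  intro h
  have hmem : ∀ t : ℂ, ((B 0)⁻¹.mulVec ![1, t, 0], 0) ∈ X.sing := fun t =>
    H.mem_sing ha hb hc ha' hb' hc' (fun h => one_ne_zero (congrFun h 0)) rfl
  obtain ⟨U, hU, hiso⟩ := h _ (hmem 0)
  have hcont : ContinuousAt (fun t : ℂ => (((B 0)⁻¹.mulVec ![1, t, 0], 0) : FibC × BaseC)) 0 := by
    refine ContinuousAt.prodMk ?_ continuousAt_const
    have h1 : Continuous fun t : ℂ => (![1, t, 0] : FibC) := by
      refine continuous_pi fun i => ?_
      fin_cases i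
      · exact continuous_const
      · exact continuous_id
      · exact continuous_const
    exact (Continuous.matrix_mulVec continuous_const h1).continuousAt
  have h2 : ∀ᶠ t : ℂ in 𝓝[≠] 0, (((B 0)⁻¹.mulVec ![1, t, 0], 0) : FibC × BaseC) ∈ U :=
    (hcont.tendsto.mono_left nhdsWithin_le_nhds).eventually hU
  obtain ⟨t, ht, ht0⟩ := (h2.and self_mem_nhdsWithin).exists
  obtain ⟨d, hd⟩ := (hiso _ ⟨ht, hmem t⟩).2
  have h3 := congrArg (B 0).mulVec hd
  simp only [Matrix.mulVec_smul, Matrix.mulVec_mulVec, Matrix.mul_nonsing_inv _ H.det_ne.isUnit,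
    Matrix.one_mulVec] at h3
  have h4 := congrFun h3 1
  simp at h4
  exact ht0 h4

end ConicBundleAction.IsBlockForm

/-- The isotypic decomposition of the linear part of a rotation invariant family of binary forms. -/
theorem weights_of_rotation_invariant {m n : ℕ} (hm : 3 ≤ m) (ho : Odd m) (hn : n.Coprime m)
    {p q A B C : ℂ} (hpq : p ^ 2 + q ^ 2 = 1) (hζ : IsPrimitiveRoot (p + Complex.I * q) m) {μ : ℂ}
    (hμ : μ = (p + Complex.I * q) ^ n)
    (h1 : p * (p * (μ * A)) - p * (q * (μ * B)) - q * (p * (μ * B)) + q * (q * (μ * C)) = A)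
    (h2 : q * (p * (μ * A)) - q * (q * (μ * B)) + p * (p * (μ * B)) - p * (q * (μ * C)) = B)
    (h3 : q * (q * (μ * A)) + p * (q * (μ * B)) + q * (p * (μ * B)) + p * (p * (μ * C)) = C) :
    C = -A ∧ ((μ = (p + Complex.I * q) ^ 2 ∧ B = Complex.I * A) ∨
      (μ * (p + Complex.I * q) ^ 2 = 1 ∧ B = -Complex.I * A) ∨ (A = 0 ∧ B = 0)) := by
  set z := p + Complex.I * q with hz
  have hzz : z * (p - Complex.I * q) = 1 := by
    rw [hz]; linear_combination hpq - q ^ 2 * Complex.I_sq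
  -- An odd m ≥ 3 does not divide 4; hence the weights 2 and -2 are different.
  have hz4 : z ^ 4 ≠ 1 := fun h => by
    have h5 := (hζ.pow_eq_one_iff_dvd 4).1 h
    have h6 := Nat.le_of_dvd (by norm_num) h5
    obtain ⟨r, hr⟩ := ho
    obtain rfl : m = 3 := by omega
    norm_num at h5
  have hμ1 : μ ≠ 1 := fun h => by
    rw [hμ, hζ.pow_eq_one_iff_dvd] at h
    have := Nat.eq_one_of_dvd_coprimes hn h dvd_rfl
    omega
  have hC : C = -A := by
    have : (μ - 1) * (A + C) = 0 := by linear_combination h1 + h3 - μ * (A + C) * hpq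
    rcases mul_eq_zero.1 this with h | h
    · exact (hμ1 (sub_eq_zero.1 h)).elim
    · linear_combination h
  -- This is the invariance evaluated at (1, i), an eigenvector of the rotation with eigenvalue z;
  -- `hminus` uses (1, -i), whose eigenvalue is the inverse of z.
  have hplus : (μ * z ^ 2 - 1) * (A + 2 * Complex.I * B - C) = 0 := by
    rw [hz]
    linear_combination h1 + 2 * Complex.I * h2 - h3 +
      μ * (q ^ 2 * A + 4 * p * q * B + 2 * Complex.I * q ^ 2 * B - q ^ 2 * C) * Complex.I_sq
  have hminus : (μ - z ^ 2) * (A - 2 * Complex.I * B - C) = 0 := by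
    have h4 : (μ * (p - Complex.I * q) ^ 2 - 1) * (A - 2 * Complex.I * B - C) = 0 := by
      linear_combination h1 - 2 * Complex.I * h2 - h3 +
        μ * (q ^ 2 * A + 4 * p * q * B - 2 * Complex.I * q ^ 2 * B - q ^ 2 * C) * Complex.I_sq
    linear_combination z ^ 2 * h4 - μ * (A - 2 * Complex.I * B - C) *
      (z * (p - Complex.I * q) + 1) * hzz
  have eplus : μ * z ^ 2 ≠ 1 → B = Complex.I * A := fun h => by
    have h5 := (mul_eq_zero.1 hplus).resolve_left (sub_ne_zero.2 h)
    rw [hC] at h5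
    linear_combination -Complex.I / 2 * h5 + B * Complex.I_sq
  have eminus : μ ≠ z ^ 2 → B = -Complex.I * A := fun h => by
    have h5 := (mul_eq_zero.1 hminus).resolve_left (sub_ne_zero.2 h)
    rw [hC] at h5
    linear_combination Complex.I / 2 * h5 + B * Complex.I_sq
  refine ⟨hC, ?_⟩
  by_cases c1 : μ = z ^ 2
  · refine Or.inl ⟨c1, eplus fun h => hz4 ?_⟩
    rw [c1] at h
    linear_combination h
  by_cases c2 : μ * z ^ 2 = 1
  · exact Or.inr (Or.inl ⟨c2, eminus c1⟩)
  · refine Or.inr (Or.inr ?_)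
    have e1 := eplus c2
    have e2 := eminus c1
    have e3 : B = 0 := by linear_combination e1 / 2 + e2 / 2
    refine ⟨?_, e3⟩
    linear_combination Complex.I * e1 - Complex.I * e3 + A * Complex.I_sq

theorem rotTwo_star (z : ℂ) : rotTwo (star z) = (rotTwo z).transpose := by
  ext i j
  fin_cases i <;> fin_cases j <;> simp [rotTwo]

namespace IsCoord

variable {φ : BaseC → BaseC} {L : BaseC ≃L[ℂ] BaseC}

theorem fderiv_apply (hL : HasFDerivAt φ (L : BaseC →L[ℂ] BaseC) 0) (i : Fin 2) (v : BaseC) :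
    fderiv ℂ (fun s => φ s i) 0 v = L v i := by
  rw [((hasFDerivAt_pi'.1 hL) i).fderiv]; rfl

/-- The differential of a real germ is a real combination of those of the coordinates. -/
theorem exists_real_coeffs (hφ : IsCoord φ) (hL : HasFDerivAt φ (L : BaseC →L[ℂ] BaseC) 0)
    {f : BaseC → ℂ} (hf : RealGerm f) :
    ∃ x y : ℝ, ∀ v, fderiv ℂ f 0 v = x * L v 0 + y * L v 1 := by
  have hLstar : ∀ v, L (star v) = star (L v) := fun v => by
    ext i
    rw [← fderiv_apply hL i, (hφ.germ i).fderiv_star, fderiv_apply hL i]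
    rfl
  have hreal : ∀ j : Fin 2, fderiv ℂ f 0 (L.symm (Pi.single j 1)) =
      ((fderiv ℂ f 0 (L.symm (Pi.single j 1))).re : ℂ) := fun j => by
    have h1 : star (L.symm (Pi.single j 1)) = L.symm (Pi.single j 1) := by
      apply L.injective
      rw [hLstar, L.apply_symm_apply]
      ext i
      by_cases h : i = j
      · subst h; simp
      · simp [h]
    have h2 := hf.fderiv_star (L.symm (Pi.single j 1))
    rw [h1] at h2
    exact (Complex.conj_eq_iff_re.1 h2.symm).symm
  refine ⟨(fderiv ℂ f 0 (L.symm (Pi.single 0 1))).re, (fderiv ℂ f 0 (L.symm (Pi.single 1 1))).re,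
    fun v => ?_⟩
  rw [← hreal 0, ← hreal 1]
  have h3 : v = L v 0 • L.symm (Pi.single 0 1) + L v 1 • L.symm (Pi.single 1 1) := by
    apply L.injective
    rw [map_add, map_smul, map_smul, L.apply_symm_apply, L.apply_symm_apply]
    ext i
    fin_cases i <;> simp
  conv_lhs => rw [h3]
  rw [map_add, map_smul, map_smul, smul_eq_mul, smul_eq_mul]
  ring

end IsCoord

namespace ConicBundleAction.IsBlockForm

variable {X : RealConicBundle} {m : ℕ} {α : ConicBundleAction X m} {g : (ZMod m)ˣ}
  {B : BaseC → Matrix (Fin 3) (Fin 3) ℂ} {a b c e : BaseC → ℂ}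

/-- The chain rule applied to the invariance at the fixed origin: the linear part of (a, b, c) is
equivariant. -/
theorem fderiv_invariant (H : α.IsBlockForm g B a b c e) (h_zero : ∀ k, α.σ k 0 = 0) {p q : ℂ}
    (hR : fibRot m 1 = !![p, q, 0; -q, p, 0; 0, 0, 1]) (v : BaseC) :
    p * (p * fderiv ℂ a 0 (fderiv ℂ (α.σ g) 0 v)) - p * (q * fderiv ℂ b 0 (fderiv ℂ (α.σ g) 0 v)) -
      q * (p * fderiv ℂ b 0 (fderiv ℂ (α.σ g) 0 v)) +
      q * (q * fderiv ℂ c 0 (fderiv ℂ (α.σ g) 0 v)) = fderiv ℂ a 0 v ∧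
    q * (p * fderiv ℂ a 0 (fderiv ℂ (α.σ g) 0 v)) - q * (q * fderiv ℂ b 0 (fderiv ℂ (α.σ g) 0 v)) +
      p * (p * fderiv ℂ b 0 (fderiv ℂ (α.σ g) 0 v)) -
      p * (q * fderiv ℂ c 0 (fderiv ℂ (α.σ g) 0 v)) = fderiv ℂ b 0 v ∧
    q * (q * fderiv ℂ a 0 (fderiv ℂ (α.σ g) 0 v)) + p * (q * fderiv ℂ b 0 (fderiv ℂ (α.σ g) 0 v)) +
      q * (p * fderiv ℂ b 0 (fderiv ℂ (α.σ g) 0 v)) +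
      p * (p * fderiv ℂ c 0 (fderiv ℂ (α.σ g) 0 v)) = fderiv ℂ c 0 v := by
  have hd : HasFDerivAt (α.σ g) (fderiv ℂ (α.σ g) 0) 0 :=
    (α.vecGerm_base g).analyticAt.differentiableAt.hasFDerivAt
  have hcomp : ∀ {f : BaseC → ℂ}, RealGerm f → ∀ x y : ℂ,
      HasFDerivAt (fun s => x * (y * f (α.σ g s)))
        (x • y • (fderiv ℂ f 0).comp (fderiv ℂ (α.σ g) 0)) 0 := fun {f} hf x y => by
    have h1 : HasFDerivAt (fun s => f (α.σ g s)) _ 0 := HasFDerivAt.comp (0 : BaseC) (g := f)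
      (by rw [h_zero]; exact hf.1.differentiableAt.hasFDerivAt) hd
    exact (h1.const_mul y).const_mul x
  have hinv := H.invariant_entries 1
  simp only [Nat.cast_one, one_mul] at hinv
  have da := ((((hcomp H.germ_a p p).sub (hcomp H.germ_b p q)).sub (hcomp H.germ_b q p)).add
    (hcomp H.germ_c q q)).congr_of_eventuallyEq (f₁ := a) (by
      filter_upwards [hinv] with s hs using (hs p q hR).1.symm)
  have db := ((((hcomp H.germ_a q p).sub (hcomp H.germ_b q q)).add (hcomp H.germ_b p p)).sub
    (hcomp H.germ_c p q)).congr_of_eventuallyEq (f₁ := b) (by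
      filter_upwards [hinv] with s hs using (hs p q hR).2.1.symm)
  have dc := ((((hcomp H.germ_a q q).add (hcomp H.germ_b p q)).add (hcomp H.germ_b q p)).add
    (hcomp H.germ_c p p)).congr_of_eventuallyEq (f₁ := c) (by
      filter_upwards [hinv] with s hs using (hs p q hR).2.2.symm)
  refine ⟨?_, ?_, ?_⟩
  · conv_rhs => rw [da.fderiv]
    simp
  · conv_rhs => rw [db.fderiv]
    simp
  · conv_rhs => rw [dc.fderiv]
    simp

/-- The case of a double line as central fibre. -/
theorem equivariantlyEquivalent_double_line (H : α.IsBlockForm g B a b c e) (hm : 2 ≤ m)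
    (ho : Odd m) (h_zero : ∀ k, α.σ k 0 = 0) (h_sing : OnlyIsolatedPts X.sing)
    (ha : a 0 = 0) (hb : b 0 = 0) (hc : c 0 = 0) {φ : BaseC → BaseC} (hφ : IsCoord φ) {n : ℕ}
    (hn : n.Coprime m)
    (hφg : ∀ᶠ s in 𝓝 (0 : BaseC), φ (α.σ g s) = (baseRot m n 1).mulVec (φ s)) :
    EquivariantlyEquivalent α (g : ZMod m) 2 normalForm₂ 2 := by
  have hm3 : 3 ≤ m := by obtain ⟨r, hr⟩ := ho; omega
  obtain ⟨L, hL⟩ := hφ.deriv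
  set ζ := Complex.exp (2 * Real.pi * Complex.I / m) with hζ
  have hζp : IsPrimitiveRoot ζ m := Complex.isPrimitiveRoot_exp m (by omega)
  set p : ℂ := (ζ.re : ℂ) with hp
  set q : ℂ := (ζ.im : ℂ) with hq
  have hζpq : ζ = p + Complex.I * q := by
    rw [mul_comm]; exact (Complex.re_add_im ζ).symm
  have hR : fibRot m 1 = !![p, q, 0; -q, p, 0; 0, 0, 1] := by
    rw [fibRot_eq, pow_one, ← hζ]
    ext i j; fin_cases i <;> fin_cases j <;> simp [rotThree, hp, hq]
  have hpq : p ^ 2 + q ^ 2 = 1 := by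
    obtain ⟨p', q', h1, h2⟩ := fibRot_shape m 1
    rw [hR] at h2
    have h3 : p = p' := congrFun (congrFun h2 0) 0
    have h4 : q = q' := congrFun (congrFun h2 0) 1
    rw [h3, h4, h1]
  set μ := ζ ^ n with hμ
  -- An eigenvector of the base rotation, with eigenvalue μ. A real functional with coefficients x,
  -- y takes the value x + iy on it, so one complex relation determines both real coefficients.
  set V : BaseC := ![1, Complex.I] with hV
  have hbase : (baseRot m n 1).mulVec V = μ • V := by
    rw [baseRot_eq, pow_one, ← hζ, ← hμ]
    have h1 : μ = μ.re + μ.im * Complex.I := (Complex.re_add_im μ).symm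
    ext i
    fin_cases i
    · simp [rotTwo, hV, Matrix.mulVec, dotProduct]
    · simp [rotTwo, hV, Matrix.mulVec, dotProduct]
      conv_rhs => rw [h1]
      linear_combination -(μ.im : ℂ) * Complex.I_sq
  have hLσ : ∀ v, L (fderiv ℂ (α.σ g) 0 v) = (baseRot m n 1).mulVec (L v) := fun v => by
    have hd : HasFDerivAt (α.σ g) (fderiv ℂ (α.σ g) 0) 0 :=
      (α.vecGerm_base g).analyticAt.differentiableAt.hasFDerivAt
    have h1 : HasFDerivAt (fun s => φ (α.σ g s)) _ 0 := HasFDerivAt.comp (0 : BaseC) (g := φ)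
      (by rw [h_zero]; exact hL) hd
    have h2 := ((Matrix.mulVecLin (baseRot m n 1)).toContinuousLinearMap.hasFDerivAt
        (x := φ 0)).comp (0 : BaseC) hL
    have h3 := h1.unique (h2.congr_of_eventuallyEq hφg)
    exact congrArg (fun T => T v) h3
  obtain ⟨a₁, a₂, hfa⟩ := hφ.exists_real_coeffs hL H.germ_a
  obtain ⟨b₁, b₂, hfb⟩ := hφ.exists_real_coeffs hL H.germ_b
  obtain ⟨c₁, c₂, hfc⟩ := hφ.exists_real_coeffs hL H.germ_c
  have hV0 : L (L.symm V) = V := L.apply_symm_apply V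
  have hV1 : L (fderiv ℂ (α.σ g) 0 (L.symm V)) = μ • V := by rw [hLσ, hV0, hbase]
  obtain ⟨h1, h2, h3⟩ := H.fderiv_invariant h_zero hR (L.symm V)
  simp only [hfa, hfb, hfc, hV0, hV1, Pi.smul_apply, smul_eq_mul] at h1 h2 h3
  have hsplit : ∀ x y : ℝ, (x : ℂ) * (μ * V 0) + y * (μ * V 1) = μ * (x + y * Complex.I) :=
    fun x y => by simp [hV]; ring
  have hsplit' : ∀ x y : ℝ, (x : ℂ) * V 0 + y * V 1 = x + y * Complex.I :=
    fun x y => by simp [hV]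
  rw [hsplit, hsplit, hsplit, hsplit'] at h1 h2 h3
  obtain ⟨hC, hcases⟩ := weights_of_rotation_invariant hm3 ho hn hpq (hζpq ▸ hζp)
    (by rw [← hζpq]) h1 h2 h3
  have hc₁ : c₁ = -a₁ := by simpa using congrArg Complex.re hC
  have hc₂ : c₂ = -a₂ := by simpa using congrArg Complex.im hC
  rw [← hζpq] at hcases
  -- The rows are the differentials of a and b in the coordinates φ, so Kφ agrees with (a, b) to
  -- first order; c is then -a to first order.
  set K : Matrix (Fin 2) (Fin 2) ℝ := !![a₁, a₂; b₁, b₂] with hK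
  have hne : ¬ (a₁ = 0 ∧ a₂ = 0 ∧ b₁ = 0 ∧ b₂ = 0) := fun ⟨h4, h5, h6, h7⟩ => by
    refine H.not_onlyIsolatedPts_sing ha hb hc ?_ ?_ ?_ h_sing
    · ext1 v; rw [hfa, h4, h5]; simp
    · ext1 v; rw [hfb, h6, h7]; simp
    · ext1 v; rw [hfc, hc₁, hc₂, h4, h5]; simp
  -- For weight 2, K is a nonzero scalar times a rotation and commutes with rotations; for weight -2
  -- it is a scalar times a reflection and inverts them. The base exponent becomes 2 in both cases.
  -- Weight zero would force K = 0.
  have hKprop : K.det ≠ 0 ∧ K * rotTwo μ = rotTwo (ζ ^ 2) * K := by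
    have hsq : ¬ (a₁ = 0 ∧ a₂ = 0) → a₁ ^ 2 + a₂ ^ 2 ≠ 0 := fun h h' => h
      ⟨by nlinarith [sq_nonneg a₁, sq_nonneg a₂], by nlinarith [sq_nonneg a₁, sq_nonneg a₂]⟩
    rcases hcases with ⟨h4, h5⟩ | ⟨h4, h5⟩ | ⟨h4, h5⟩
    · have e1 : b₁ = -a₂ := by simpa using congrArg Complex.re h5
      have e2 : b₂ = a₁ := by simpa using congrArg Complex.im h5
      refine ⟨fun h => hsq (fun h' => hne ⟨h'.1, h'.2, by rw [e1, h'.2, neg_zero], by rw [e2, h'.1]⟩)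
        ?_, ?_⟩
      · rw [hK, Matrix.det_fin_two_of, e1, e2] at h
        linear_combination h
      · rw [h4, hK, e1, e2]
        ext i j
        fin_cases i <;> fin_cases j <;> simp [rotTwo, Matrix.mul_apply, Fin.sum_univ_two] <;> ring
    · have e1 : b₁ = a₂ := by simpa using congrArg Complex.re h5
      have e2 : b₂ = -a₁ := by simpa using congrArg Complex.im h5
      refine ⟨fun h => hsq (fun h' => hne ⟨h'.1, h'.2, by rw [e1, h'.2], by rw [e2, h'.1, neg_zero]⟩)
        ?_, ?_⟩
      · rw [hK, Matrix.det_fin_two_of, e1, e2] at h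
        linear_combination -h
      · have h6 : rotTwo μ = (rotTwo (ζ ^ 2)).transpose := by
          have hconj : μ = star (ζ ^ 2) := by
            refine mul_right_cancel₀ (pow_ne_zero 2 (hζp.ne_zero (by omega))) (h4.trans ?_)
            rw [Complex.star_def, Complex.conj_mul', norm_pow, hζp.norm'_eq_one (by omega)]
            simp
          rw [hconj, rotTwo_star]
        rw [h6, hK, e1, e2]
        ext i j
        fin_cases i <;> fin_cases j <;> simp [rotTwo, Matrix.mul_apply, Fin.sum_univ_two] <;> ring
    · refine (hne ⟨?_, ?_, ?_, ?_⟩).elim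
      · simpa using congrArg Complex.re h4
      · simpa using congrArg Complex.im h4
      · simpa using congrArg Complex.re h5
      · simpa using congrArg Complex.im h5
  have hcoord := hφ.mulVec hKprop.1
  have hw0 : VecGerm fun w : BaseC => w := fun i =>
    ⟨(ContinuousLinearMap.proj (R := ℂ) (φ := fun _ : Fin 2 => ℂ) i).analyticAt 0,
      Eventually.of_forall fun _ => rfl⟩
  have hKv : ∀ s, ((K.map Complex.ofReal).mulVec (φ s)) 0 = a₁ * φ s 0 + a₂ * φ s 1 ∧
      ((K.map Complex.ofReal).mulVec (φ s)) 1 = b₁ * φ s 0 + b₂ * φ s 1 := fun s => by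
    simp [hK, Matrix.mulVec, dotProduct]
  have hbig : ∀ {f : BaseC → ℂ} (x y : ℝ), RealGerm f → f 0 = 0 →
      (∀ v, fderiv ℂ f 0 v = x * L v 0 + y * L v 1) →
      (fun s => f s - (x * φ s 0 + y * φ s 1)) =O[𝓝 0] fun s => ‖s‖ ^ 2 :=
    fun {f} x y hf h0 hfd => by
    have hg : RealGerm fun s => (x : ℂ) * φ s 0 + y * φ s 1 :=
      ((RealGerm.ofReal x).mul (hφ.germ 0)).add ((RealGerm.ofReal y).mul (hφ.germ 1))
    refine (hf.sub hg).isBigO_norm_sq (by simp [h0, hφ.map_zero]) ?_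
    have hd : HasFDerivAt (fun s => f s - (x * φ s 0 + y * φ s 1)) _ 0 :=
      hf.1.differentiableAt.hasFDerivAt.sub
        (((hφ.germ 0).1.differentiableAt.hasFDerivAt.const_mul (x : ℂ)).add
          ((hφ.germ 1).1.differentiableAt.hasFDerivAt.const_mul (y : ℂ)))
    rw [hd.fderiv]
    ext1 v
    simp [hfd, IsCoord.fderiv_apply hL]
  have hzero : ∀ f : BaseC → ℂ, (∀ s, f s = 0) → f =O[𝓝 0] fun s => ‖s‖ ^ 2 := fun f hf => by
    rw [show f = fun _ => 0 from funext hf]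
    exact isBigO_zero _ _
  refine α.equivariantlyEquivalent_of_germs hm h_zero hcoord ?_ H.matGerm H.det_ne ?_
    (matGerm_blockForm H.germ_a H.germ_b H.germ_c)
    (Eventually.of_forall fun s => blockForm_isSymm _ _ _) ?_
    (M := fun w => blockForm (w 0) (w 1) (-w 0)) (matGerm_blockForm (hw0 0) (hw0 1) (hw0 0).neg)
    (fun w => blockForm_isSymm _ _ _) (fun w v => ?_) (fun i j => ?_)
  · filter_upwards [hφg] with s hs
    rw [hs, baseRot_eq, baseRot_eq, pow_one, pow_one, ← hζ, ← hμ, Matrix.mulVec_mulVec,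
      Matrix.mulVec_mulVec, ← map_ofReal_mul, ← map_ofReal_mul, hKprop.2]
  · simpa using H.linear 1
  · filter_upwards [H.equation, H.germ_e.eventually_ne H.e_ne] with s h4 h5
    exact ⟨e s, h5, h4⟩
  · rw [quadVal_blockForm, normalForm₂]
    ring
  · have ea := hbig a₁ a₂ H.germ_a ha hfa
    have eb := hbig b₁ b₂ H.germ_b hb hfb
    have ec := hbig c₁ c₂ H.germ_c hc hfc
    simp only [(hKv _).1, (hKv _).2]
    fin_cases i <;> fin_cases j
    · exact ea
    · exact eb
    · exact hzero _ fun s => by simp [blockForm]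
    · exact eb
    · refine ec.congr_left fun s => ?_
      simp [blockForm, hc₁, hc₂]
      ring
    · exact hzero _ fun s => by simp [blockForm]
    · exact hzero _ fun s => by simp [blockForm]
    · exact hzero _ fun s => by simp [blockForm]
    · exact hzero _ fun s => by simp [blockForm]

end ConicBundleAction.IsBlockForm

theorem mainTheorem7 (m : ℕ) (hm : 2 ≤ m) (X : RealConicBundle) (α : ConicBundleAction X m)
    (h_zero : ∀ k, α.σ k 0 = 0)
    (h_sing : OnlyIsolatedPts X.sing)
    (h_real : ∃ p ∈ X.total, p.2 = 0 ∧ IsRealPt p)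
    (h_fix : ∀ k : ZMod m, k ≠ 0 →
      OnlyIsolatedPts (α.fixedPts k) ∧ ∀ p ∈ α.fixedPts k, ¬ IsRealPt p) :
    ∃ g : (ZMod m)ˣ,
      (∃ b : ℕ, Nat.Coprime b m ∧ EquivariantlyEquivalent α (g : ZMod m) b normalForm₁ 1) ∨
      (Odd m ∧ EquivariantlyEquivalent α (g : ZMod m) 2 normalForm₂ 2) := by
  have h_fix' : ∀ k : ZMod m, k ≠ 0 → ∀ p ∈ α.fixedPts k, ¬ IsRealPt p := fun k hk =>
    (h_fix k hk).2
  obtain ⟨g, B₀, hB₀, hB₀d, hB₀A⟩ := α.exists_fibre_linearization hm h_zero h_real h_fix'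
  obtain ⟨B, a, b, c, e, H⟩ := α.exists_isBlockForm hm h_zero h_fix' hB₀ hB₀d hB₀A
  obtain ⟨n, φ, hn, hφ, hφg⟩ := H.exists_base_rotation hm h_zero
    (H.disc_pos_of_even h_zero hm h_fix') fun k hk => (h_fix k hk).1
  refine ⟨g, ?_⟩
  rcases H.central_fibre h_zero hm h_real h_fix' with ⟨ha, hd⟩ | ⟨ho, ha, hb, hc⟩
  · exact Or.inl ⟨n, hn, H.equivariantlyEquivalent_smooth hm h_zero ha hd hφ hφg⟩
  · exact Or.inr ⟨ho, H.equivariantlyEquivalent_double_line hm ho h_zero h_sing ha hb hc hφ hn hφg⟩
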